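/- **Setting.** Let $m\ge 2$ be even, $q\ge1$, $n=N=mq$, and consider spins $\sigma\in\{\pm1\}^{\mathbb Z/n}$ on the periodic one-dimensional lattice, divided into $M=m$ cells $C_k=\{kq,\dots,kq+q-1\}$, $k\in\mathbb Z/m$. Write $\sigma^k=\sigma|_{C_k}$ and $F(\sigma)=\eta$ with $\eta(k)=\sum_{x\in C_k}\sigma(x)$. Let $\beta>0$ and $S<q<L$ ($S\in\mathbb N$, $L\in\mathbb R$). Let $H_N=H^s_N+H^l_N$ with $$H^s_N(\sigma)=\sum_{X}U_X(\sigma),\qquad H^l_N(\sigma)=-\tfrac12\sum_x\sum_{y\ne x}J(x-y)\sigma(x)\sigma(y),\qquad J(x)=\tfrac1L V(|x|/L),$$ where $U=(U_X)$ is a translation invariant potential (indexed by nonempty finite $X\subset\mathbb Z$, read periodically) with $U_X=0$ for $\operatorname{diam}X>S$, $|x|$ is the distance to $0$ on the periodic lattice, and $V\in C^1([0,\infty))$ with $V(r)=0$ for $r>1$. Put $\|U\|=\sum_{X\ni0}\|U_X\|_\infty$ and $\|\nabla V\|_\infty=\sup_{r\ge0}|V'(r)|$. Let $P_N=\prod_xP_x$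 be a product probability measure, $\mu_N\propto e^{-\beta H_N}P_N$, $\bar P_M=P_N\circ F^{-1}$, and let $P_N(d\sigma|\eta)=\prod_kP_k(d\sigma^k|\eta(k))$ be the conditional prior. *First approximation.* Let $\bar J(k,l)=q^{-2}\sum_{x\in C_k,y\in C_l}J(x-y)$ for $k\ne l$, $\bar J(k,k)=\frac1{q(q-1)}\sum_{x\ne y\in C_k}J(x-y)$ (and $\bar J(k,k)=0$ if $q=1$), and $$\bar H^{l,(0)}(\eta)=-\tfrac12\sum_{k}\sum_{l\ne k}\bar J(k,l)\eta(k)\eta(l)-\tfrac12\sum_k\bar J(k,k)(\eta(k)^2-q),$$ which equals $E[H_N^l\,|\,\eta]$ whenever the $P_x$ with $x$ in the same cell coincide. Let $H^s_k$ be the sum of $U_X$ over $X\subset C_k$ and $W_{k,k+1}$ the sum over the $X$ meeting both $C_k$ and $C_{k+1}$. Let $$Z_k(\eta(k);\sigma^{k-1},\sigma^{k+1})=\int e^{-\beta(W_{k-1,k}+H^s_k+W_{k,k+1})}P_k(d\sigma^k|\eta(k)),$$ where a boundary condition $0$ means that the corresponding $W$ is omitted, and let $Z_{k-1,k,k+1}$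 be the integral of $e^{-\beta(H^s_{k-1}+W_{k-1,k}+H^s_k+W_{k,k+1}+H^s_{k+1})}$ against $P_{k-1}(d\sigma^{k-1}|\eta(k-1))P_k(d\sigma^k|\eta(k))P_{k+1}(d\sigma^{k+1}|\eta(k+1))$. Put $$\bar H^{(0)}=\bar H^{l,(0)}+\frac1\beta\sum_{k\text{ odd}}\log Z_k(\eta(k);0,0)-\frac1\beta\sum_{k\text{ even}}\log Z_{k-1,k,k+1},\qquad \bar\mu^{(0)}\propto e^{-\beta\bar H^{(0)}}\bar P_M.$$ *First correction.* Let $$f^s_{k-1,k+1}=\frac{Z_k(\eta(k);\sigma^{k-1},\sigma^{k+1})\,Z_k(\eta(k);0,0)}{Z_k(\eta(k);0,\sigma^{k+1})\,Z_k(\eta(k);\sigma^{k-1},0)}-1,\qquad f^l_{kl}=e^{-\beta\Delta_{kl}J}-1,$$ $$\Delta_{kl}J(\sigma)=-\tfrac12(2-\delta_{kl})\sum_{x\in C_k,\,y\in C_l,\,y\ne x}(J(x-y)-\bar J(k,l))\sigma(x)\sigma(y),$$ and let $\nu(d\sigma|\eta)$ be the reference measure $$\prod_{k\text{ odd}}\frac{e^{-\beta(H^s_k+W_{k-1,k}+W_{k,k+1})}}{Z_k(\eta(k);\sigma^{k-1},\sigma^{k+1})}P_k(d\sigma^k|\eta(k))\prod_{k\text{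 even}}\frac{e^{-\beta H^s_k}Z_{k+1}(\eta(k+1);\sigma^k,0)Z_{k-1}(\eta(k-1);0,\sigma^k)}{Z_{k-1,k,k+1}}P_k(d\sigma^k|\eta(k)).$$ The residual is the part of the cluster expansion of $-\frac1\beta\log\int\prod_{k\text{ odd}}(1+f^s_{k-1,k+1})\prod_{k\le l}(1+f^l_{kl})\,d\nu$ given by the single-bond polymers: $$S(\eta)=\bar H^{(1)}_M(\eta)=-\frac1\beta\Big(\sum_{k\text{ odd}}\int f^s_{k-1,k+1}\,d\nu(\cdot|\eta)+\sum_{k\le l}\int f^l_{kl}\,d\nu(\cdot|\eta)\Big).$$ **Statement.** Let $\delta=\frac{\beta\|U\|S}{q}+\frac{q\beta\|\nabla V\|_\infty}{L}$. There are absolute constants $\delta_0,\delta_1,C>0$ such that for every model as above with $|f^s_{k-1,k+1}|\le\delta_0$ for all odd $k$, all $\sigma^{k-1},\sigma^{k+1}$ and all values $\eta(k)$ of positive prior probability, and $|f^l_{kl}|\le\delta_1$ for all $k,l,\sigma$, the relative entropy is finite and $$\Big|\mathcal R(\bar\mu^{(0)}\,|\,\mu_N\circ F^{-1})-\beta\,\mathbb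 E_{\bar\mu^{(0)}}[S(\eta)]-\log\mathbb E_{\bar\mu^{(0)}}[e^{-\beta S(\eta)}]\Big|\le C\,M\,(q\delta)^2 .$$ That is, the error is $O(\delta^2)$ per coarse cell for fixed $q$, uniformly in $M$, $L$, $\beta$, $U$, $V$ and the prior. -/

import Mathlib

open MeasureTheory ProbabilityTheory

noncomputable section

namespace CoarseGraining

/-- Ising spins `+1`, `-1`. -/
abbrev Spin := ℤˣ

instance : DiscreteMeasurableSpace Spin where
  forall_measurableSet s :=
    ⟨Units.val '' s, MeasurableSet.of_discrete, Set.preimage_image_eq s Units.val_injective⟩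

/-- The periodic microscopic lattice with `n = m * q` sites. -/
abbrev Site (m q : ℕ) := ZMod (m * q)

/-- Microscopic configurations. -/
abbrev Micro (m q : ℕ) := Site m q → Spin

/-- Configurations of one coarse cell, which has `q` sites. -/
abbrev CellConf (q : ℕ) := Fin q → Spin

/-- Coarse configurations on the periodic coarse lattice with `m` cells. -/
abbrev Coarse (m : ℕ) := ZMod m → ℤ

/-- The `i`-th site `k q + i` of the cell `C_k`. -/
def site {m q : ℕ} (k : ZMod m) (i : Fin q) : Site m q := ((k.val * q + i.val : ℕ) : ZMod (m * q))

/-- The restriction `σ^k` of `σ` to the cell `C_k`. -/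
def cellOf {m q : ℕ} (σ : Micro m q) (k : ZMod m) : CellConf q := fun i => σ (site k i)

/-- The block spin of a cell configuration. -/
def blockSpin {q : ℕ} (τ : CellConf q) : ℤ := ∑ i, (τ i : ℤ)

/-- The coarse-graining map `F`. -/
def coarseMap {m q : ℕ} (σ : Micro m q) : Coarse m := fun k => blockSpin (cellOf σ k)

/-- A many-body potential on `ℤ`: a function `U_X` of the spins in `X` for every finite `X`. -/
abbrev Potential := (X : Finset ℤ) → (X → Spin) → ℝ

/-- `U_{X+y} = U_X`, the spins being carried along. -/
def Potential.TranslationInvariant (U : Potential) : Prop :=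
  ∀ (X : Finset ℤ) (y : ℤ) (s : ℤ → Spin),
    U (X.map (addRightEmbedding y)) (fun x => s x) = U X (fun x => s (x + y))

/-- `U_X = 0` whenever `diam X > S`. -/
def Potential.HasRange (U : Potential) (S : ℕ) : Prop :=
  ∀ X : Finset ℤ, (∃ x ∈ X, ∃ y ∈ X, (S : ℤ) < |x - y|) → U X = 0

/-- `‖U‖`, the sum of the sup norms of `U_X` over the sets `X ∋ 0` of diameter at most `S`. -/
def Potential.size (U : Potential) (S : ℕ) : ℝ :=
  ∑ X ∈ (Finset.Icc (-(S : ℤ)) S).powerset with (0 ∈ X ∧ ∀ x ∈ X, ∀ y ∈ X, |x - y| ≤ (S : ℤ)), ‖U X‖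

/-- The model: `m` cells of `q` sites, temperature, potentials and prior. -/
structure Model (m q : ℕ) where
  /-- inverse temperature -/
  β : ℝ
  β_pos : 0 < β
  /-- range of the short-range interaction -/
  S : ℕ
  /-- range of the long-range interaction -/
  L : ℝ
  S_lt : S < q
  lt_L : (q : ℝ) < L
  /-- short-range potential -/
  U : Potential
  U_transl : U.TranslationInvariant
  U_range : U.HasRange S
  /-- profile of the long-range two-body potential -/
  V : ℝ → ℝ
  V_smooth : ContDiffOn ℝ 1 V (Set.Ici 0)
  V_support : ∀ r, 1 < r → V r = 0
  /-- single-site prior distributions -/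
  P : Site m q → Measure Spin
  P_prob : ∀ x, IsProbabilityMeasure (P x)

namespace Model

variable {m q : ℕ} (A : Model m q)

/-! ### Microscopic model -/

/-- The short-range Hamiltonian, the sum of `U_X(σ)` over the nonempty sets `X` of sites of the
periodic lattice. As `U` has range `S < q`, such a set is represented by exactly one set `X` of
integers with least element `x` in `[0, n)` and contained in `[x, x + S]`; `σ` is read
periodically. -/
def shortHamiltonian (σ : Micro m q) : ℝ :=
  ∑ x ∈ Finset.Ico (0 : ℤ) ((m * q : ℕ) : ℤ),
    ∑ X ∈ (Finset.Icc x (x + (A.S : ℤ))).powerset with x ∈ X,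
      A.U X (fun y => σ ((y : ℤ) : ZMod (m * q)))

/-- `J(x) = L⁻¹ V(|x| / L)`, where `|x|` is the distance of `x` to `0` on the periodic lattice. -/
def J (x : Site m q) : ℝ := 1 / A.L * A.V (|(x.valMinAbs : ℝ)| / A.L)

/-- The long-range Hamiltonian. -/
def longHamiltonian [NeZero m] [NeZero q] (σ : Micro m q) : ℝ :=
  -(1 / 2) * ∑ x : Site m q, ∑ y : Site m q with y ≠ x, A.J (x - y) * (σ x : ℤ) * (σ y : ℤ)

/-- The Hamiltonian `H_N`. -/
def hamiltonian [NeZero m] [NeZero q] (σ : Micro m q) : ℝ :=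
  A.shortHamiltonian σ + A.longHamiltonian σ

/-- The prior `P_N`, a product measure. -/
def prior [NeZero m] [NeZero q] : Measure (Micro m q) := Measure.pi A.P

/-- The Gibbs measure `Z_N⁻¹ exp(-β H_N) P_N`. -/
def gibbs [NeZero m] [NeZero q] : Measure (Micro m q) :=
  A.prior.tilted (fun σ => -A.β * A.hamiltonian σ)

/-! ### Coarse-graining -/

/-- The coarse-grained prior `P_N ∘ F⁻¹`. -/
def coarsePrior [NeZero m] [NeZero q] : Measure (Coarse m) := A.prior.map coarseMap

/-- The exact coarse-grained Gibbs measure `μ_N ∘ F⁻¹`. -/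
def exactCoarseGibbs [NeZero m] [NeZero q] : Measure (Coarse m) := A.gibbs.map coarseMap

/-- The conditional prior `P_N(dσ | η)`. -/
def condPrior [NeZero m] [NeZero q] (η : Coarse m) : Measure (Micro m q) :=
  ProbabilityTheory.cond A.prior {σ | coarseMap σ = η}

/-- The prior on the cell `C_k`. -/
def cellPrior (k : ZMod m) : Measure (CellConf q) := Measure.pi (fun i => A.P (site k i))

/-- The conditional prior `P_k(dσ^k | a)` on the cell `C_k`, given the block spin `a`. -/
def condCell (k : ZMod m) (a : ℤ) : Measure (CellConf q) :=
  ProbabilityTheory.cond (A.cellPrior k) {τ | blockSpin τ = a}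

/-! ### Long-range part of the first approximation -/

/-- The averaged interaction of two cells. -/
def Jbar (k l : ZMod m) : ℝ :=
  if k = l then
    1 / ((q : ℝ) * (q - 1)) * ∑ i : Fin q, ∑ j : Fin q with j ≠ i, A.J (site k i - site k j)
  else 1 / (q : ℝ) ^ 2 * ∑ i : Fin q, ∑ j : Fin q, A.J (site k i - site l j)

/-- The long-range part of the first approximation. -/
def longCoarse [NeZero m] (η : Coarse m) : ℝ :=
  -(1 / 2) * ∑ k : ZMod m, ∑ l : ZMod m with l ≠ k, A.Jbar k l * η k * η l
    - 1 / 2 * ∑ k : ZMod m, A.Jbar k k * ((η k : ℝ) ^ 2 - q)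

/-- `Δ_{kl} J(σ)`, the error made in the interaction of `C_k` and `C_l`. -/
def longError (k l : ZMod m) (σ : Micro m q) : ℝ :=
  -(1 / 2) * ∑ i : Fin q, ∑ j : Fin q with site l j ≠ site k i,
    (A.J (site k i - site l j) - A.Jbar k l) * (σ (site k i) : ℤ) * (σ (site l j) : ℤ)
      * (2 - if k = l then 1 else 0)

/-- `f^l_{kl}`. -/
def fLong (k l : ZMod m) (σ : Micro m q) : ℝ := Real.exp (-A.β * A.longError k l σ) - 1

end Model

section

variable {m q : ℕ}

/-- Distinct cells are disjoint, and distinct positions in a cell are distinct sites. -/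
theorem site_inj [NeZero m] [NeZero q] {k l : ZMod m} {i j : Fin q} :
    (site k i : Site m q) = site l j ↔ k = l ∧ i = j := by
  constructor
  · intro h
    unfold site at h
    rw [ZMod.natCast_eq_natCast_iff'] at h
    have hq : 0 < q := Nat.pos_of_neZero q
    have hlt : ∀ (k : ZMod m) (i : Fin q), k.val * q + i.val < m * q := fun k i => by
      have h1 := ZMod.val_lt k
      have h2 := i.isLt
      nlinarith
    rw [Nat.mod_eq_of_lt (hlt k i), Nat.mod_eq_of_lt (hlt l j)] at h
    have h1 : (k.val * q + i.val) / q = (l.val * q + j.val) / q := by rw [h]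
    have h2 : (k.val * q + i.val) % q = (l.val * q + j.val) % q := by rw [h]
    rw [mul_comm, mul_comm l.val, Nat.mul_add_div hq, Nat.mul_add_div hq,
      Nat.div_eq_of_lt i.isLt, Nat.div_eq_of_lt j.isLt] at h1
    rw [mul_comm, mul_comm l.val, Nat.mul_add_mod, Nat.mul_add_mod,
      Nat.mod_eq_of_lt i.isLt, Nat.mod_eq_of_lt j.isLt] at h2
    exact ⟨ZMod.val_injective m (by omega), Fin.ext h2⟩
  · rintro ⟨rfl, rfl⟩
    rfl

theorem sum_site [NeZero m] [NeZero q] (g : Site m q → ℝ) :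
    ∑ x, g x = ∑ k : ZMod m, ∑ i : Fin q, g (site k i) := by
  have hb : Function.Bijective (fun p : ZMod m × Fin q => (site p.1 p.2 : Site m q)) := by
    rw [Fintype.bijective_iff_injective_and_card]
    refine ⟨fun a b h => Prod.ext_iff.2 (site_inj.1 h), ?_⟩
    simp [ZMod.card]
  rw [← Fintype.sum_prod_type', ← hb.sum_comp g]

theorem coarseMap_swap [NeZero m] [NeZero q] (k : ZMod m) (i i' : Fin q) (σ : Micro m q) :
    coarseMap (fun x => σ (Equiv.swap (site k i) (site k i') x)) = coarseMap σ := by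
  classical
  funext l
  unfold coarseMap blockSpin cellOf
  by_cases h : l = k
  · subst h
    have hinj : Function.Injective (fun j : Fin q => (site l j : Site m q)) :=
      fun a b hab => (site_inj.1 hab).2
    rw [← Equiv.sum_comp (Equiv.swap i i') (fun j => ((σ (site l j) : Spin) : ℤ))]
    refine Finset.sum_congr rfl fun j _ => ?_
    rw [← hinj.swap_apply i i' j]
  · refine Finset.sum_congr rfl fun j _ => ?_
    dsimp only
    rw [Equiv.swap_apply_of_ne_of_ne] <;> (rw [Ne, site_inj]; tauto)

theorem condPrior_swap [NeZero m] [NeZero q] (A : Model m q) (η : Coarse m) (k : ZMod m)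
    (i i' : Fin q) (hP : A.P (site k i) = A.P (site k i')) (g : Micro m q → ℝ) :
    ∫ σ, g (fun x => σ (Equiv.swap (site k i) (site k i') x)) ∂(A.condPrior η)
      = ∫ σ, g σ ∂(A.condPrior η) := by
  classical
  have := A.P_prob
  set e : Equiv.Perm (Site m q) := Equiv.swap (site k i) (site k i') with he
  have hPe : (fun x => A.P (e x)) = A.P := by
    funext x
    rw [he, Equiv.swap_apply_def]
    split_ifs with h1 h2
    · rw [h1, hP]
    · rw [h2, hP]
    · rfl
  have hfun : (fun σ : Micro m q => fun x => σ (e x))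
      = ⇑(MeasurableEquiv.piCongrLeft (fun _ : Site m q => Spin) e) := by
    funext σ x
    obtain ⟨y, rfl⟩ := e.surjective x
    rw [MeasurableEquiv.coe_piCongrLeft, Equiv.piCongrLeft_apply_apply]
    congr 1
    rw [he, Equiv.swap_apply_self]
  have h1 := measurePreserving_piCongrLeft (α := fun _ : Site m q => Spin) A.P e
  rw [← hfun] at h1
  have h1' : MeasurePreserving (fun σ : Micro m q => fun x => σ (e x)) A.prior A.prior := by
    unfold Model.prior
    convert h1 using 2
    exact hPe.symm
  have h2 := h1'.restrict_preimage (s := {σ | coarseMap σ = η}) (MeasurableSet.of_discrete)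
  have h3 : (fun σ : Micro m q => fun x => σ (e x)) ⁻¹' {σ | coarseMap σ = η}
      = {σ | coarseMap σ = η} := by
    ext σ
    simp only [Set.mem_preimage, Set.mem_ofPred_eq]
    rw [he, coarseMap_swap]
  rw [h3] at h2
  have h4 := h2.smul_measure (A.prior {σ | coarseMap σ = η})⁻¹
  refine MeasurePreserving.integral_comp (ν := A.condPrior η) h4 ?_ g
  rw [hfun]
  exact MeasurableEquiv.measurableEmbedding _

/-- If the prior distributions of the spins in a cell agree, `longCoarse` is the conditional
expectation of the long-range Hamiltonian given the coarse configuration. -/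
theorem longCoarse_eq_integral [NeZero m] [NeZero q] (A : Model m q)
    (hP : ∀ (k : ZMod m) (i j : Fin q), A.P (site k i) = A.P (site k j))
    (η : Coarse m) (hη : A.prior {σ | coarseMap σ = η} ≠ 0) :
    A.longCoarse η = ∫ σ, A.longHamiltonian σ ∂(A.condPrior η) := by
  classical
  have := A.P_prob
  have : IsProbabilityMeasure A.prior := by unfold Model.prior; infer_instance
  have : IsProbabilityMeasure (A.condPrior η) := cond_isProbabilityMeasure hη
  have hint : ∀ g : Micro m q → ℝ, Integrable g (A.condPrior η) := fun g => Integrable.of_finite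
  have hae : ∀ᵐ σ ∂(A.condPrior η), coarseMap σ = η :=
    ae_cond_mem (s := {σ : Micro m q | coarseMap σ = η}) MeasurableSet.of_discrete
  have hsum : ∀ k, ∀ᵐ σ ∂(A.condPrior η), ∑ i : Fin q, ((σ (site k i) : ℤ) : ℝ) = η k := by
    intro k
    filter_upwards [hae] with σ hσ
    rw [← hσ]
    simp [coarseMap, blockSpin, cellOf]
  have hcst : ∀ r : ℝ, ∫ _, r ∂(A.condPrior η) = r := fun r => by simp
  set c : Site m q → Site m q → ℝ :=
    fun x y => ∫ σ, ((σ x : ℤ) : ℝ) * ((σ y : ℤ) : ℝ) ∂(A.condPrior η) with hc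
  have hswap : ∀ (k : ZMod m) (i i' : Fin q) (x y : Site m q),
      c (Equiv.swap (site k i) (site k i') x) (Equiv.swap (site k i) (site k i') y) = c x y := by
    intro k i i' x y
    exact condPrior_swap A η k i i' (hP k i i')
      (fun σ => ((σ x : ℤ) : ℝ) * ((σ y : ℤ) : ℝ))
  have hinj : ∀ k : ZMod m, Function.Injective (fun j : Fin q => (site k j : Site m q)) :=
    fun k a b hab => (site_inj.1 hab).2
  have hsw : ∀ (k : ZMod m) (i i' j : Fin q),
      Equiv.swap (site k i : Site m q) (site k i') (site k j) = site k (Equiv.swap i i' j) :=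
    fun k i i' j => (hinj k).swap_apply i i' j
  have hsw' : ∀ (k l : ZMod m) (i i' j : Fin q), k ≠ l →
      Equiv.swap (site k i : Site m q) (site k i') (site l j) = site l j := by
    intro k l i i' j hkl
    rw [Equiv.swap_apply_of_ne_of_ne] <;> (rw [Ne, site_inj]; tauto)
  -- correlations of two cells
  have hoff : ∀ (k l : ZMod m), k ≠ l → ∀ i j : Fin q,
      (q : ℝ) ^ 2 * c (site k i) (site l j) = η k * η l := by
    intro k l hkl i j
    have h1 : ∀ i' j', c (site k i') (site l j') = c (site k i) (site l j) := by
      intro i' j'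
      have e1 := hswap k i' i (site k i') (site l j')
      rw [hsw, hsw' _ _ _ _ _ hkl, Equiv.swap_apply_left] at e1
      have e2 := hswap l j' j (site k i) (site l j')
      rw [hsw, hsw' _ _ _ _ _ hkl.symm, Equiv.swap_apply_left] at e2
      rw [← e1, ← e2]
    have h2 : ∑ i' : Fin q, ∑ j' : Fin q, c (site k i') (site l j') = η k * η l := by
      simp only [hc]
      simp_rw [← integral_finsetSum Finset.univ (fun _ _ => hint _)]
      rw [← hcst ((η k : ℝ) * η l)]
      refine integral_congr_ae ?_
      filter_upwards [hsum k, hsum l] with σ h1 h2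
      rw [← h1, ← h2, Finset.sum_mul_sum]
    simp_rw [h1] at h2
    simp at h2
    rw [← h2]; ring
  -- correlations inside a cell
  have hdiag : ∀ (k : ZMod m) (i j : Fin q), j ≠ i →
      (q : ℝ) * (q - 1) * c (site k i) (site k j) = (η k : ℝ) ^ 2 - q := by
    intro k i j hij
    have h1 : ∀ i' j', j' ≠ i' → c (site k i') (site k j') = c (site k i) (site k j) := by
      intro i' j' hij'
      have e1 := hswap k i' i (site k i') (site k j')
      rw [hsw, hsw, Equiv.swap_apply_left] at e1
      set j'' := Equiv.swap i' i j' with hj''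
      have hne : j'' ≠ i := by
        intro h
        have : Equiv.swap i' i j' = Equiv.swap i' i i' := by
          rw [Equiv.swap_apply_left, ← hj'', h]
        exact hij' ((Equiv.swap i' i).injective this)
      have e2 := hswap k j'' j (site k i) (site k j'')
      rw [hsw, hsw, Equiv.swap_apply_left,
        Equiv.swap_apply_of_ne_of_ne hne.symm hij.symm] at e2
      rw [← e1, ← e2]
    have hself : ∀ i', c (site k i') (site k i') = 1 := by
      intro i'
      simp only [hc]
      have : ∀ u : Spin, ((u : ℤ) : ℝ) * ((u : ℤ) : ℝ) = 1 := by
        intro u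
        rcases Int.units_eq_one_or u with h | h <;> simp [h]
      simp [this]
    have h2 : ∑ i' : Fin q, ∑ j' : Fin q, c (site k i') (site k j') = η k * η k := by
      simp only [hc]
      simp_rw [← integral_finsetSum Finset.univ (fun _ _ => hint _)]
      rw [← hcst ((η k : ℝ) * η k)]
      refine integral_congr_ae ?_
      filter_upwards [hsum k] with σ h1
      rw [← h1, Finset.sum_mul_sum]
    have h3 : ∀ i' j' : Fin q, c (site k i') (site k j')
        = c (site k i) (site k j) + if j' = i' then 1 - c (site k i) (site k j) else 0 := by
      intro i' j'
      split_ifs with h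
      · subst h; rw [hself]; ring
      · rw [h1 i' j' h]; ring
    rw [Finset.sum_congr rfl fun i' _ => Finset.sum_congr rfl fun j' _ => h3 i' j'] at h2
    simp_rw [Finset.sum_add_distrib, Finset.sum_ite_eq'] at h2
    simp at h2
    linarith [h2, mul_comm (q : ℝ) (c (site k i) (site k j))]
  -- the expectation of the Hamiltonian
  have hH : ∫ σ, A.longHamiltonian σ ∂(A.condPrior η) = -(1 / 2) * ∑ k : ZMod m, ∑ l : ZMod m,
      ∑ i : Fin q, ∑ j : Fin q, if site l j ≠ site k i then
        A.J (site k i - site l j) * c (site k i) (site l j) else 0 := by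
    unfold Model.longHamiltonian
    rw [integral_const_mul]
    congr 1
    rw [integral_finsetSum _ (fun _ _ => hint _), sum_site]
    refine Finset.sum_congr rfl fun k _ => ?_
    rw [Finset.sum_comm]
    refine Finset.sum_congr rfl fun i _ => ?_
    rw [integral_finsetSum _ (fun _ _ => hint _), Finset.sum_filter, sum_site]
    refine Finset.sum_congr rfl fun l _ => Finset.sum_congr rfl fun j _ => ?_
    congr 1
    simp only [hc, mul_assoc]
    rw [integral_const_mul]
  rw [hH]
  have hq0 : (q : ℝ) ≠ 0 := Nat.cast_ne_zero.2 (NeZero.ne q)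
  have hpair : ∀ k l : ZMod m, (∑ i : Fin q, ∑ j : Fin q, if site l j ≠ site k i then
        A.J (site k i - site l j) * c (site k i) (site l j) else 0)
      = (if l ≠ k then A.Jbar k l * η k * η l else 0)
        + if l = k then A.Jbar k k * ((η k : ℝ) ^ 2 - q) else 0 := by
    intro k l
    by_cases h : l = k
    · subst h
      simp only [ne_eq, not_true_eq_false, if_false, if_true, zero_add, site_inj, true_and]
      unfold Model.Jbar
      simp only [if_true, Finset.sum_filter]
      rw [Finset.mul_sum, Finset.sum_mul]
      refine Finset.sum_congr rfl fun i _ => ?_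
      rw [Finset.mul_sum, Finset.sum_mul]
      refine Finset.sum_congr rfl fun j _ => ?_
      by_cases hij : j = i
      · simp [hij]
      · have hq1 : (q : ℝ) - 1 ≠ 0 := by
          intro h1
          have h2 : q = 1 := by exact_mod_cast (sub_eq_zero.1 h1)
          subst h2
          exact hij (Subsingleton.elim _ _)
        rw [if_pos hij, if_pos hij, ← hdiag l i j hij]
        field_simp
    · have h' : ¬ k = l := fun hh => h hh.symm
      simp only [ne_eq, h, not_false_eq_true, if_true, if_false, add_zero, site_inj, false_and]
      unfold Model.Jbar
      rw [if_neg h', mul_assoc, Finset.mul_sum, Finset.sum_mul]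
      refine Finset.sum_congr rfl fun i _ => ?_
      rw [Finset.mul_sum, Finset.sum_mul]
      refine Finset.sum_congr rfl fun j _ => ?_
      rw [← hoff k l h' i j]
      field_simp
  simp_rw [hpair, Finset.sum_add_distrib, Finset.sum_ite_eq']
  unfold Model.longCoarse
  simp only [Finset.sum_filter, Finset.mem_univ, if_true]
  ring

end

/-! ### Short-range part of the first approximation -/

/-- The configuration that is `τ` on `[0, q)` and `τ'` on `[q, 2q)`; its values at other integers
are not used. -/
def glue {q : ℕ} (τ τ' : CellConf q) (x : ℤ) : Spin :=
  if h : x.toNat < q then τ ⟨x.toNat, h⟩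
  else if h : x.toNat - q < q then τ' ⟨x.toNat - q, h⟩ else 1

namespace Model

variable {m q : ℕ} (A : Model m q)

/-- `H^s_k`, the energy of a cell with free boundary conditions: all nonempty `X ⊆ C_k`
contribute. By translation invariance the cell is placed at `[0, q)`. -/
def cellEnergy (τ : CellConf q) : ℝ :=
  ∑ X ∈ (Finset.Ico (0 : ℤ) q).powerset with X.Nonempty, A.U X (fun x => glue τ τ x)

/-- `W_{k,k+1}`, the interaction energy of two adjacent cells: all `X` which meet both of them
contribute. By translation invariance the cells are placed at `[0, q)` and `[q, 2q)`. -/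
def bondEnergy (τ τ' : CellConf q) : ℝ :=
  ∑ X ∈ (Finset.Ico (0 : ℤ) (2 * q)).powerset with
      ((∃ x ∈ X, x < (q : ℤ)) ∧ ∃ x ∈ X, (q : ℤ) ≤ x),
    A.U X (fun x => glue τ τ' x)

/-- The interaction with a left neighbour; `none` is the free boundary condition. -/
def leftEnergy (b : Option (CellConf q)) (τ : CellConf q) : ℝ :=
  b.elim 0 (fun τ' => A.bondEnergy τ' τ)

/-- The interaction with a right neighbour; `none` is the free boundary condition. -/
def rightEnergy (τ : CellConf q) (b : Option (CellConf q)) : ℝ :=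
  b.elim 0 (fun τ' => A.bondEnergy τ τ')

/-- The one-cell partition function `Z_k(a; b, b')` with boundary conditions `b`, `b'`, where
`none` stands for a free boundary. -/
def Z (k : ZMod m) (a : ℤ) (b b' : Option (CellConf q)) : ℝ :=
  ∫ τ, Real.exp (-A.β * (A.leftEnergy b τ + A.rightEnergy τ b')) *
    Real.exp (-A.β * A.cellEnergy τ) ∂(A.condCell k a)

/-- The three-cell partition function `Z_{k-1,k,k+1}(a₁, a₂, a₃; 0, 0)` with free boundaries. -/
def Z3 (k : ZMod m) (a₁ a₂ a₃ : ℤ) : ℝ :=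
  ∫ τ₁, ∫ τ₂, ∫ τ₃, Real.exp (-A.β * (A.cellEnergy τ₁ + A.bondEnergy τ₁ τ₂ + A.cellEnergy τ₂
      + A.bondEnergy τ₂ τ₃ + A.cellEnergy τ₃))
    ∂(A.condCell (k + 1) a₃) ∂(A.condCell k a₂) ∂(A.condCell (k - 1) a₁)

/-- `f^s_{k-1,k+1}(a; τ, τ')`. -/
def fShort (k : ZMod m) (a : ℤ) (τ τ' : CellConf q) : ℝ :=
  A.Z k a (some τ) (some τ') * A.Z k a none none /
    (A.Z k a none (some τ') * A.Z k a (some τ) none) - 1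

/-- The short-range part of the first approximation, `exp(-β ·) = ∏_odd Z_k⁻¹ ∏_even Z_{k-1,k,k+1}`. -/
def shortCoarse [NeZero m] (η : Coarse m) : ℝ :=
  1 / A.β * ∑ k : ZMod m with Odd k.val, Real.log (A.Z k (η k) none none)
    - 1 / A.β * ∑ k : ZMod m with Even k.val, Real.log (A.Z3 k (η (k - 1)) (η k) (η (k + 1)))

/-- The first approximation of the coarse-grained Hamiltonian. -/
def coarse0 [NeZero m] (η : Coarse m) : ℝ := A.longCoarse η + A.shortCoarse η

/-- The zeroth-order coarse-grained Gibbs measure. -/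
def coarseGibbs0 [NeZero m] [NeZero q] : Measure (Coarse m) :=
  A.coarsePrior.tilted (fun η => -A.β * A.coarse0 η)

/-! ### The reference measure and the first correction -/

/-- The density of `ν(dσ | η)` with respect to `P_N(dσ | η)`. -/
def nuDensity [NeZero m] (η : Coarse m) (σ : Micro m q) : ℝ :=
  (∏ k : ZMod m with Odd k.val,
    Real.exp (-A.β * (A.cellEnergy (cellOf σ k) + A.bondEnergy (cellOf σ (k - 1)) (cellOf σ k)
        + A.bondEnergy (cellOf σ k) (cellOf σ (k + 1)))) /
      A.Z k (η k) (some (cellOf σ (k - 1))) (some (cellOf σ (k + 1)))) *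
  ∏ k : ZMod m with Even k.val,
    Real.exp (-A.β * A.cellEnergy (cellOf σ k)) *
        A.Z (k + 1) (η (k + 1)) (some (cellOf σ k)) none *
        A.Z (k - 1) (η (k - 1)) none (some (cellOf σ k)) /
      A.Z3 k (η (k - 1)) (η k) (η (k + 1))

/-- The reference measure `ν(dσ | η)`. -/
def nu [NeZero m] [NeZero q] (η : Coarse m) : Measure (Micro m q) :=
  (A.condPrior η).withDensity (fun σ => ENNReal.ofReal (A.nuDensity η σ))

/-- The first correction: `-1/β` times the sum of the activities of all polymers that consist of
a single bond, i.e. the part of the cluster expansion of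
`-1/β log ∫ ∏_{k odd} (1 + f^s_{k-1,k+1}) ∏_{k ≤ l} (1 + f^l_{kl}) dν`
which is linear in the factors `f^s` and `f^l`. -/
def coarse1 [NeZero m] [NeZero q] (η : Coarse m) : ℝ :=
  -(1 / A.β) *
    ((∑ k : ZMod m with Odd k.val,
        ∫ σ, A.fShort k (η k) (cellOf σ (k - 1)) (cellOf σ (k + 1)) ∂(A.nu η)) +
      ∑ p : ZMod m × ZMod m with p.1.val ≤ p.2.val, ∫ σ, A.fLong p.1 p.2 σ ∂(A.nu η))

/-- `‖∇V‖_∞`, the supremum of `|V'|` on `[0, ∞)`. -/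
def gradNorm : ℝ := ⨆ r : Set.Ici (0 : ℝ), |derivWithin A.V (Set.Ici 0) r|

/-- The small parameter `δ = β ‖U‖ S / q + q β ‖∇V‖ / L`. -/
def delta : ℝ := A.β * A.U.size A.S * A.S / q + q * A.β * A.gradNorm / A.L

end Model

end CoarseGraining

end

noncomputable section

namespace CoarseGraining

/-! ### Bounded differences for directed product measures -/

section BoundedDifferences

open Finset

/-! For a coarse configuration `η` of positive prior probability the Boltzmann weight factorises
exactly: e^{-βH} is e^{-βH̄⁰(η)} times the density of ν times e^Λ, where Λ (`totalLog`) is the sum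
of all log(1 + f) (`exp_hamiltonian`). Hence the exact coarse measure is `coarseGibbs0` tilted by
log G, with G(η) = ∫ e^Λ dν (`correction`, `exactCoarseGibbs_eq`). The relative entropy of a
probability measure with respect to its tilt by g is log E[e^g] - E[g] (`klDiv_tilted_right`).
Replacing g = log G by -βS changes each of these two terms by at most the supremum of |log G + βS|,
so it suffices to bound the latter by a constant times m(qδ)² (`abs_log_correction_sub_le`).

No cluster expansion is summed for this. Jensen's inequality gives log G ≥ ∫ Λ dν. Conversely, ν is
a directed product: the even cells are independent, and given them the odd cells are independent,
each depending on its two neighbours only. A bounded difference inequality for such measures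
(`IsTwoLayer.sum_exp_le`) gives log G ≤ ∫ Λ dν + 9mc², where c bounds the oscillation of Λ in one
cell. This c is O(qδ): a cell enters at most two short-range factors, each with logarithm O(βS‖U‖),
and O(L/q) long-range factors, each with logarithm O(βq³‖∇V‖/L²).

Finally, if Λ = ∑ x over the bonds, then -βS is the ν-mean of ∑ (e^x - 1), and |e^x - 1 - x| ≤ x²
for the small x at hand. The sum of these squares is again O(m(qδ)²) (`abs_coarse1_sub_le`). -/

theorem exp_le_add_exp_sq (x : ℝ) : Real.exp x ≤ x + Real.exp (x ^ 2) := by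
  have h2 : x ^ 2 + 1 ≤ Real.exp (x ^ 2) := Real.add_one_le_exp _
  by_cases h : |x| ≤ 1
  · have h1 := (abs_le.1 (Real.abs_exp_sub_one_sub_id_le h)).2
    linarith
  · rcases lt_abs.1 (not_le.1 h) with h | h
    · have : Real.exp x ≤ Real.exp (x ^ 2) := Real.exp_le_exp.2 (by nlinarith)
      linarith
    · have : Real.exp x ≤ 1 := Real.exp_le_one_iff.2 (by linarith)
      nlinarith

variable {ι X : Type*} [Fintype ι] [DecidableEq ι] [Fintype X]

/-- The average of `g` over the coordinate `k` with weights `p ω`. -/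
def siteAverage (p : (ι → X) → X → ℝ) (k : ι) (g : (ι → X) → ℝ) (ω : ι → X) : ℝ :=
  ∑ τ, p ω τ * g (Function.update ω k τ)

omit [Fintype ι] in
-- A substitute for Hoeffding's lemma: the deviation of g from its average is centred and bounded by
-- c, so e^x ≤ x + e^{x²} bounds its exponential moment by e^{c²}.
theorem siteAverage_exp_le {p : (ι → X) → X → ℝ} (hp : ∀ ω τ, 0 ≤ p ω τ)
    (hp1 : ∀ ω, ∑ τ, p ω τ = 1) {k : ι} {g : (ι → X) → ℝ} {c : ℝ}
    (hc : ∀ ω τ τ', |g (Function.update ω k τ) - g (Function.update ω k τ')| ≤ c) (ω : ι → X) :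
    siteAverage p k (fun ω => Real.exp (g ω)) ω ≤ Real.exp (siteAverage p k g ω + c ^ 2) := by
  set a := siteAverage p k g ω with ha
  have hdev : ∀ τ, |g (Function.update ω k τ) - a| ≤ c := by
    intro τ
    have : g (Function.update ω k τ) - a
        = ∑ τ', p ω τ' * (g (Function.update ω k τ) - g (Function.update ω k τ')) := by
      simp_rw [mul_sub, sum_sub_distrib, ← sum_mul, hp1, one_mul]
      rfl
    rw [this]
    refine (abs_sum_le_sum_abs _ _).trans ?_
    calc ∑ τ', |p ω τ' * (g (Function.update ω k τ) - g (Function.update ω k τ'))|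
        ≤ ∑ τ', p ω τ' * c := by
          refine sum_le_sum fun τ' _ => ?_
          rw [abs_mul, abs_of_nonneg (hp _ _)]
          exact mul_le_mul_of_nonneg_left (hc _ _ _) (hp _ _)
      _ = c := by rw [← sum_mul, hp1, one_mul]
  have hzero : ∑ τ, p ω τ * (g (Function.update ω k τ) - a) = 0 := by
    simp_rw [mul_sub, sum_sub_distrib, ← sum_mul, hp1, one_mul]
    exact sub_self _
  calc siteAverage p k (fun ω => Real.exp (g ω)) ω
      = Real.exp a * ∑ τ, p ω τ * Real.exp (g (Function.update ω k τ) - a) := by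
        rw [siteAverage, mul_sum]
        refine sum_congr rfl fun τ _ => ?_
        rw [Real.exp_sub]
        field_simp
    _ ≤ Real.exp a * ∑ τ, p ω τ * ((g (Function.update ω k τ) - a) + Real.exp (c ^ 2)) := by
        gcongr with τ _
        · exact hp _ _
        · refine (exp_le_add_exp_sq _).trans ?_
          have := sq_le_sq' (by linarith [(abs_le.1 (hdev τ)).1]) (abs_le.1 (hdev τ)).2
          gcongr
    _ = Real.exp (a + c ^ 2) := by
        simp_rw [mul_add, sum_add_distrib]
        rw [hzero, ← sum_mul, hp1, zero_add, one_mul, Real.exp_add]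

omit [Fintype ι] in
/-- Oscillation in another coordinate, when the weights do not depend on that coordinate. -/
theorem siteAverage_update_sub_le {p : (ι → X) → X → ℝ} (hp : ∀ ω τ, 0 ≤ p ω τ)
    (hp1 : ∀ ω, ∑ τ, p ω τ = 1) {k j : ι} (hjk : j ≠ k) {g : (ι → X) → ℝ} {c : ℝ}
    (hc : ∀ ω τ τ', |g (Function.update ω j τ) - g (Function.update ω j τ')| ≤ c)
    (hpj : ∀ ω τ, p (Function.update ω j τ) = p ω) (ω : ι → X) (τ τ' : X) :
    |siteAverage p k g (Function.update ω j τ) - siteAverage p k g (Function.update ω j τ')| ≤ c := by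
  rw [siteAverage, siteAverage, ← sum_sub_distrib]
  refine (abs_sum_le_sum_abs _ _).trans ?_
  calc _ ≤ ∑ x, p ω x * c := by
        refine sum_le_sum fun x _ => ?_
        rw [hpj, hpj, ← mul_sub, abs_mul, abs_of_nonneg (hp _ _), Function.update_comm hjk,
          Function.update_comm hjk]
        exact mul_le_mul_of_nonneg_left (hc _ _ _) (hp _ _)
    _ = c := by rw [← sum_mul, hp1, one_mul]

omit [Fintype ι] in
/-- Oscillation in another coordinate, when the weights depend on that coordinate. -/
theorem siteAverage_update_sub_le_add {p : (ι → X) → X → ℝ} (hp : ∀ ω τ, 0 ≤ p ω τ)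
    (hp1 : ∀ ω, ∑ τ, p ω τ = 1) {k j : ι} (hjk : j ≠ k) {g : (ι → X) → ℝ} {c d : ℝ}
    (hc : ∀ ω τ τ', |g (Function.update ω j τ) - g (Function.update ω j τ')| ≤ c)
    (hd : ∀ ω τ τ', |g (Function.update ω k τ) - g (Function.update ω k τ')| ≤ d)
    (ω : ι → X) (τ τ' : X) :
    |siteAverage p k g (Function.update ω j τ) - siteAverage p k g (Function.update ω j τ')|
      ≤ c + d := by
  set u := Function.update ω j τ with hu
  set v := Function.update ω j τ' with hv
  have huv : ∀ x, |g (Function.update u k x) - g (Function.update v k x)| ≤ c := by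
    intro x
    rw [hu, hv, Function.update_comm hjk, Function.update_comm hjk]
    exact hc _ _ _
  -- The two averages use different weights at k; coupling them independently turns the difference
  -- into one double average. Each term is then bounded by moving j (cost c) and afterwards k (cost
  -- d).
  have e : siteAverage p k g u - siteAverage p k g v
      = ∑ x, ∑ y, p u x * p v y * (g (Function.update u k x) - g (Function.update v k y)) := by
    simp_rw [mul_sub, sum_sub_distrib]
    congr 1
    · refine sum_congr rfl fun x _ => ?_
      rw [← sum_mul, ← mul_sum, hp1, mul_one]
    · rw [sum_comm]
      refine sum_congr rfl fun x _ => ?_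
      rw [← sum_mul, ← sum_mul, hp1, one_mul]
  rw [e]
  calc _ ≤ ∑ x, ∑ y, |p u x * p v y * (g (Function.update u k x) - g (Function.update v k y))| :=
        (abs_sum_le_sum_abs _ _).trans (sum_le_sum fun x _ => abs_sum_le_sum_abs _ _)
    _ ≤ ∑ x, ∑ y, p u x * p v y * (c + d) := by
        refine sum_le_sum fun x _ => sum_le_sum fun y _ => ?_
        have h0 := mul_nonneg (hp u x) (hp v y)
        rw [abs_mul, abs_of_nonneg h0]
        refine mul_le_mul_of_nonneg_left ?_ h0
        exact (abs_sub_le _ (g (Function.update v k x)) _).trans (add_le_add (huv x) (hd _ _ _))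
    _ = c + d := by
        simp_rw [← sum_mul, ← mul_sum, hp1, mul_one, hp1, one_mul]

/-- Integrating out one coordinate. -/
theorem sum_eq_siteAverage [Nonempty X] {p : (ι → X) → X → ℝ} {k : ι} {a g : (ι → X) → ℝ}
    (hpk : ∀ ω τ, p (Function.update ω k τ) = p ω)
    (ha : ∀ ω τ, a (Function.update ω k τ) = a ω) :
    ∑ ω, p ω (ω k) * a ω * g ω = (Fintype.card X : ℝ)⁻¹ * ∑ ω, a ω * siteAverage p k g ω := by
  have hX : (Fintype.card X : ℝ) ≠ 0 := Nat.cast_ne_zero.2 Fintype.card_ne_zero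
  rw [eq_inv_mul_iff_mul_eq₀ hX]
  -- The sum still runs over the coordinate k after it has been integrated out; this idle summation
  -- accounts for the factor `Fintype.card X`.
  have h1 : (Fintype.card X : ℝ) * ∑ ω, p ω (ω k) * a ω * g ω
      = ∑ z : (ι → X) × X, p z.1 (z.1 k) * a z.1 * g z.1 := by
    rw [Fintype.sum_prod_type, mul_sum]
    refine sum_congr rfl fun ω _ => ?_
    simp
  have h2 : ∑ ω, a ω * siteAverage p k g ω
      = ∑ z : (ι → X) × X, a z.1 * (p z.1 z.2 * g (Function.update z.1 k z.2)) := by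
    rw [Fintype.sum_prod_type]
    refine sum_congr rfl fun ω _ => ?_
    rw [siteAverage, mul_sum]
  rw [h1, h2]
  -- Exchanging the value at k with the spare value τ is an involution that carries one double sum
  -- into the other.
  let e : (ι → X) × X → (ι → X) × X := fun z => (Function.update z.1 k z.2, z.1 k)
  have he : Function.Involutive e := by
    rintro ⟨ω, τ⟩
    simp [e]
  refine Fintype.sum_equiv he.toPerm _ _ ?_ |>.symm
  rintro ⟨ω, τ⟩
  simp only [Function.Involutive.coe_toPerm, e, Function.update_self, hpk, ha]
  ring

/-! ### Successive elimination of the coordinates. -/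

variable (p : ι → (ι → X) → X → ℝ)

/-- The expectation after the coordinates in `s` have been integrated out. -/
def partialExpectation (s : Finset ι) (g : (ι → X) → ℝ) : ℝ :=
  ((Fintype.card X : ℝ)⁻¹) ^ s.card * ∑ ω, (∏ k ∈ sᶜ, p k ω (ω k)) * g ω

variable {p}

theorem partialExpectation_mono (hp : ∀ k ω τ, 0 ≤ p k ω τ) (s : Finset ι) {g h : (ι → X) → ℝ}
    (hgh : ∀ ω, g ω ≤ h ω) : partialExpectation p s g ≤ partialExpectation p s h := by
  unfold partialExpectation
  gcongr with ω _
  · exact prod_nonneg fun _ _ => hp _ _ _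
  · exact hgh ω

theorem partialExpectation_const_mul (s : Finset ι) (c : ℝ) (g : (ι → X) → ℝ) :
    partialExpectation p s (fun ω => c * g ω) = c * partialExpectation p s g := by
  unfold partialExpectation
  rw [mul_left_comm, mul_sum (a := c)]
  congr 1
  exact sum_congr rfl fun ω _ => by ring

/-- A coordinate can be eliminated only when no remaining weight depends on it; this dictates the
order of integration. -/
theorem partialExpectation_insert [Nonempty X] {s : Finset ι} {k : ι} (hk : k ∉ s)
    (hpk : ∀ j ∉ s, ∀ ω τ, p j (Function.update ω k τ) = p j ω) (g : (ι → X) → ℝ) :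
    partialExpectation p s g = partialExpectation p (insert k s) (siteAverage (p k) k g) := by
  unfold partialExpectation
  rw [card_insert_of_notMem hk, pow_succ, mul_assoc]
  congr 1
  have hsc : sᶜ = insert k (insert k s)ᶜ := by
    ext j
    simp only [mem_compl, mem_insert]
    by_cases h : j = k <;> simp [h, hk]
  rw [← sum_eq_siteAverage (p := p k) (k := k) (a := fun ω => ∏ j ∈ (insert k s)ᶜ, p j ω (ω j))
    (hpk k hk)]
  · refine sum_congr rfl fun ω _ => ?_
    rw [hsc, prod_insert (by simp)]
  · intro ω τ
    refine prod_congr rfl fun j hj => ?_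
    simp only [mem_compl, mem_insert, not_or] at hj
    rw [hpk j hj.2, Function.update_of_ne hj.1]

/-- `adj j` is the set of the coordinates whose weights depend on the coordinate `j`. -/
structure IsTwoLayer (p : ι → (ι → X) → X → ℝ) (adj : ι → Finset ι) : Prop where
  nonneg : ∀ k ω τ, 0 ≤ p k ω τ
  sum_eq_one : ∀ k ω, ∑ τ, p k ω τ = 1
  indep : ∀ j k, k ∉ adj j → ∀ ω τ, p k (Function.update ω j τ) = p k ω
  adj_adj : ∀ j, ∀ k ∈ adj j, adj k = ∅
  card_le : ∀ j, (adj j).card ≤ 2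

/-- The bound of the oscillation in the coordinate `j` after the coordinates in `s` have been
integrated out. -/
def oscBound (adj : ι → Finset ι) (c : ℝ) (s : Finset ι) (j : ι) : ℝ :=
  if j ∈ s then 0 else c * (1 + (adj j ∩ s).card)

/-- The state of the inductive proof of the bounded difference inequality. -/
def IsReduction (p : ι → (ι → X) → X → ℝ) (adj : ι → Finset ι) (c : ℝ) (g : (ι → X) → ℝ)
    (s : Finset ι) : Prop :=
  (∀ j ∈ s, adj j ⊆ s) ∧ partialExpectation p ∅ (fun _ => 1) = partialExpectation p s (fun _ => 1) ∧
  ∃ h : (ι → X) → ℝ, partialExpectation p ∅ g = partialExpectation p s h ∧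
    partialExpectation p ∅ (fun ω => Real.exp (g ω))
      ≤ Real.exp (s.card * (9 * c ^ 2)) * partialExpectation p s (fun ω => Real.exp (h ω)) ∧
    ∀ j ω τ τ', |h (Function.update ω j τ) - h (Function.update ω j τ')| ≤ oscBound adj c s j

/-- Eliminating k costs a factor exp of the squared current oscillation in k. The remaining
oscillations are unchanged, except in the coordinates j on which the weights of k depend: there the
oscillation of k is added. -/
theorem IsReduction.insert [Nonempty X] {adj : ι → Finset ι} (hp : IsTwoLayer p adj) {c : ℝ}
    (hc : 0 ≤ c) {g : (ι → X) → ℝ} {s : Finset ι} (hs : IsReduction p adj c g s) {k : ι}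
    (hk : k ∉ s) (hks : adj k ⊆ s) : IsReduction p adj c g (insert k s) := by
  obtain ⟨hcl, hone, h, hg, hexp, hosc⟩ := hs
  have hpk : ∀ j ∉ s, ∀ ω τ, p j (Function.update ω k τ) = p j ω :=
    fun j hj => hp.indep k j fun hjk => hj (hks hjk)
  have hkk : k ∉ adj k := fun hh => hk (hks hh)
  refine ⟨?_, ?_, siteAverage (p k) k h, ?_, ?_, ?_⟩
  · intro j hj
    rcases mem_insert.1 hj with rfl | hj
    · exact hks.trans (subset_insert _ _)
    · exact (hcl j hj).trans (subset_insert _ _)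
  · rw [hone, partialExpectation_insert hk hpk]
    congr 1
    funext ω
    simp [siteAverage, hp.sum_eq_one]
  · rw [hg, partialExpectation_insert hk hpk]
  · refine hexp.trans ?_
    rw [partialExpectation_insert hk hpk, card_insert_of_notMem hk]
    -- The coordinate k has its own oscillation c and has inherited at most one further c from each
    -- of at most two eliminated dependents: (3c)² = 9c².
    have hck : oscBound adj c s k ^ 2 ≤ 9 * c ^ 2 := by
      rw [oscBound, if_neg hk]
      have h1 : ((adj k ∩ s).card : ℝ) ≤ 2 := by
        exact_mod_cast (card_le_card inter_subset_left).trans (hp.card_le k)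
      have h2 : c * (1 + ((adj k ∩ s).card : ℝ)) ≤ 3 * c := by nlinarith
      have h3 : 0 ≤ c * (1 + ((adj k ∩ s).card : ℝ)) := by positivity
      nlinarith
    have hle : partialExpectation p (Insert.insert k s)
          (siteAverage (p k) k fun ω => Real.exp (h ω))
        ≤ Real.exp (9 * c ^ 2) * partialExpectation p (Insert.insert k s)
          (fun ω => Real.exp (siteAverage (p k) k h ω)) := by
      rw [← partialExpectation_const_mul]
      refine partialExpectation_mono hp.nonneg _ fun ω => ?_
      refine (siteAverage_exp_le (hp.nonneg k) (hp.sum_eq_one k) (hosc k) ω).trans ?_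
      rw [← Real.exp_add]
      exact Real.exp_le_exp.2 (by linarith)
    refine (mul_le_mul_of_nonneg_left hle (Real.exp_pos _).le).trans_eq ?_
    rw [← mul_assoc, ← Real.exp_add]
    congr 2
    push_cast
    ring
  · intro j ω τ τ'
    by_cases hjk : j = k
    · subst hjk
      have : ∀ x, siteAverage (p j) j h (Function.update ω j x) = siteAverage (p j) j h ω := by
        intro x
        simp [siteAverage, hp.indep j j hkk]
      rw [this, this]
      simp [oscBound]
    by_cases hkj : k ∈ adj j
    -- As s is closed under dependence, j is still present. The coordinate k has no dependents, so
    -- it contributes just c to the oscillation in j.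
    · have hjs : j ∉ s := fun hj => hk (hcl j hj hkj)
      have e := siteAverage_update_sub_le_add (hp.nonneg k) (hp.sum_eq_one k) hjk (hosc j) (hosc k)
        ω τ τ'
      refine e.trans_eq ?_
      rw [oscBound, oscBound, oscBound, if_neg hjs, if_neg hk, hp.adj_adj j k hkj,
        if_neg (by simp [hjk, hjs]), inter_insert_of_mem hkj,
        card_insert_of_notMem (by simp [hk])]
      push_cast [empty_inter, card_empty]
      ring
    · have e := siteAverage_update_sub_le (hp.nonneg k) (hp.sum_eq_one k) hjk (hosc j)
        (hp.indep j k hkj) ω τ τ'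
      refine e.trans_eq ?_
      rw [oscBound, oscBound, inter_insert_of_notMem hkj]
      simp [hjk]

/-- The coordinates without dependents are eliminated before all others. By `adj_adj`, all
dependents of any other coordinate are then gone. -/
theorem IsReduction.of_osc [Nonempty X] {adj : ι → Finset ι} (hp : IsTwoLayer p adj) {c : ℝ}
    (hc : 0 ≤ c) {g : (ι → X) → ℝ}
    (hg : ∀ j ω τ τ', |g (Function.update ω j τ) - g (Function.update ω j τ')| ≤ c) :
    IsReduction p adj c g univ := by
  have h0 : IsReduction p adj c g ∅ := by
    refine ⟨by simp, rfl, g, rfl, by simp, ?_⟩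
    simpa [oscBound] using hg
  have h1 : ∀ s : Finset ι, (∀ j ∈ s, adj j = ∅) → IsReduction p adj c g s := by
    intro s
    induction s using Finset.induction_on with
    | empty => exact fun _ => h0
    | insert k s hk ih =>
      intro h
      refine (ih fun j hj => h j (mem_insert_of_mem hj)).insert hp hc hk ?_
      rw [h k (mem_insert_self _ _)]
      exact empty_subset _
  set O : Finset ι := univ.filter fun j => adj j = ∅ with hO
  have h2 : ∀ t : Finset ι, IsReduction p adj c g (O ∪ t) := by
    intro t
    induction t using Finset.induction_on with
    | empty => exact h1 _ (by simp [hO])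
    | insert k t hk ih =>
      rw [union_insert]
      by_cases hmem : k ∈ O ∪ t
      · rwa [insert_eq_of_mem hmem]
      · refine ih.insert hp hc hmem fun j hj => mem_union_left _ ?_
        simpa [hO] using hp.adj_adj k j hj
  have h3 := h2 univ
  rwa [union_eq_right.2 (subset_univ O)] at h3

omit [Fintype X] in
theorem eq_of_update_eq [Nonempty X] {h : (ι → X) → ℝ}
    (hh : ∀ j ω τ τ', h (Function.update ω j τ) = h (Function.update ω j τ')) (ω ω' : ι → X) :
    h ω = h ω' := by
  have : ∀ s : Finset ι, h (s.piecewise ω' ω) = h ω := by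
    intro s
    induction s using Finset.induction_on with
    | empty => simp
    | insert k s hk ih =>
      rw [← ih, piecewise_insert, hh k _ _ (s.piecewise ω' ω k), Function.update_eq_self]
  simpa using (this univ).symm

theorem partialExpectation_univ (g : (ι → X) → ℝ) :
    partialExpectation p univ g
      = ((Fintype.card X : ℝ)⁻¹) ^ Fintype.card ι * ∑ ω, g ω := by
  simp [partialExpectation, Finset.card_univ]

/-- A two-layer directed product of probability weights is a probability weight. -/
theorem IsTwoLayer.sum_prod_eq_one [Nonempty X] {adj : ι → Finset ι} (hp : IsTwoLayer p adj) :
    ∑ ω, ∏ k, p k ω (ω k) = 1 := by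
  -- Only the conservation of total mass under elimination is needed, so g = 0 and c = 0 will do.
  obtain ⟨-, h, -⟩ := IsReduction.of_osc hp le_rfl (c := 0) (g := fun _ => 0) (by simp)
  have hX : (Fintype.card X : ℝ) ≠ 0 := Nat.cast_ne_zero.2 Fintype.card_ne_zero
  rw [partialExpectation_univ] at h
  simp only [partialExpectation, card_empty, pow_zero, compl_empty, mul_one, one_mul, sum_const,
    card_univ, Fintype.card_fun, nsmul_eq_mul, Nat.cast_pow] at h
  rw [h, inv_pow, inv_mul_cancel₀ (pow_ne_zero _ hX)]

/-- The bounded difference inequality for a two-layer directed product. -/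
theorem IsTwoLayer.sum_exp_le [Nonempty X] {adj : ι → Finset ι} (hp : IsTwoLayer p adj) {c : ℝ}
    (hc : 0 ≤ c) {g : (ι → X) → ℝ}
    (hg : ∀ j ω τ τ', |g (Function.update ω j τ) - g (Function.update ω j τ')| ≤ c) :
    ∑ ω, (∏ k, p k ω (ω k)) * Real.exp (g ω)
      ≤ Real.exp (∑ ω, (∏ k, p k ω (ω k)) * g ω + Fintype.card ι * (9 * c ^ 2)) := by
  obtain ⟨-, -, h, hgh, hexp, hosc⟩ := IsReduction.of_osc hp hc hg
  -- After all eliminations no oscillation is left, so h is a constant, necessarily the mean of g.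
  have hconst := eq_of_update_eq (h := h) fun j ω τ τ' => by
    have := hosc j ω τ τ'
    rw [oscBound, if_pos (mem_univ _)] at this
    exact sub_eq_zero.1 (abs_nonpos_iff.1 this)
  obtain ⟨ω₀⟩ : Nonempty (ι → X) := inferInstance
  have hX : (Fintype.card X : ℝ) ≠ 0 := Nat.cast_ne_zero.2 Fintype.card_ne_zero
  have hE : ∀ f : ℝ → ℝ, partialExpectation p univ (fun ω => f (h ω)) = f (h ω₀) := by
    intro f
    have : ∀ ω, f (h ω) = f (h ω₀) := fun ω => by rw [hconst ω ω₀]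
    rw [partialExpectation_univ]
    simp only [this, sum_const, card_univ, Fintype.card_fun, nsmul_eq_mul, Nat.cast_pow]
    rw [← mul_assoc, inv_pow, inv_mul_cancel₀ (pow_ne_zero _ hX), one_mul]
  rw [hE Real.exp] at hexp
  have hid := hE id
  simp only [id] at hid
  rw [hid] at hgh
  rw [← hgh, ← Real.exp_add] at hexp
  simp only [partialExpectation, card_empty, pow_zero, compl_empty, one_mul] at hexp
  refine hexp.trans_eq ?_
  rw [add_comm, card_univ]

/-- Jensen's inequality for the exponential function. -/
theorem exp_sum_mul_le {Ω : Type*} [Fintype Ω] {w : Ω → ℝ} (hw : ∀ ω, 0 ≤ w ω)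
    (hw1 : ∑ ω, w ω = 1) (g : Ω → ℝ) :
    Real.exp (∑ ω, w ω * g ω) ≤ ∑ ω, w ω * Real.exp (g ω) := by
  have := convexOn_exp.map_sum_le (t := univ) (w := w) (p := g) (fun ω _ => hw ω) hw1
    (fun _ _ => Set.mem_univ _)
  simpa using this

end BoundedDifferences

/-! ### The short-range interaction -/

section ShortRange

open Finset

variable {m q : ℕ}

/-- The site at position `i` of the cell `t`, an integer which is read modulo `m`. -/
theorem intCast_eq_site [NeZero m] (t : ℤ) (i : Fin q) :
    ((t * q + i.val : ℤ) : Site m q) = site (t : ZMod m) i := by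
  have h : (site (t : ZMod m) i : Site m q)
      = (((((t : ZMod m).val * q + i.val : ℕ) : ℤ)) : ZMod (m * q)) := by
    rw [Int.cast_natCast]
    rfl
  rw [h]
  refine (ZMod.intCast_eq_intCast_iff_dvd_sub _ _ _).2 ?_
  push_cast
  rw [ZMod.val_intCast]
  refine ⟨-(t / m), ?_⟩
  have := Int.emod_add_mul_ediv t m
  linear_combination (q : ℤ) * this

theorem val_site [NeZero m] (k : ZMod m) (i : Fin q) :
    (site k i : Site m q).val = k.val * q + i.val := by
  unfold site
  rw [ZMod.val_natCast, Nat.mod_eq_of_lt]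
  have h1 := ZMod.val_lt k
  have h2 := i.isLt
  nlinarith

theorem sum_Ico_eq_sum_site [NeZero m] [NeZero q] (f : ℤ → ℝ) :
    ∑ x ∈ Ico (0 : ℤ) ((m * q : ℕ) : ℤ), f x
      = ∑ k : ZMod m, ∑ i : Fin q, f (i.val + (k.val * q : ℕ)) := by
  have h : ∑ x ∈ Ico (0 : ℤ) ((m * q : ℕ) : ℤ), f x = ∑ y : Site m q, f y.val := by
    refine sum_nbij' (fun x => (x : Site m q)) (fun y => (y.val : ℤ)) ?_ ?_ ?_ ?_ ?_
    · simp
    · intro y _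
      have := ZMod.val_lt y
      rw [mem_Ico]
      omega
    · intro x hx
      rw [mem_Ico] at hx
      rw [ZMod.val_intCast, Int.emod_eq_of_lt hx.1 hx.2]
    · intro y _
      simp
    · intro x hx
      rw [mem_Ico] at hx
      rw [ZMod.val_intCast, Int.emod_eq_of_lt hx.1 hx.2]
  rw [h, sum_site]
  refine sum_congr rfl fun k _ => sum_congr rfl fun i _ => ?_
  rw [val_site]
  congr 1
  push_cast
  ring

/-- Close to the cell `C_k`, the spins are those of `C_k` and `C_{k+1}`. -/
theorem spin_eq_glue [NeZero m] (σ : Micro m q) (k : ZMod m) {y : ℤ} (h0 : 0 ≤ y)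
    (h1 : y < 2 * q) :
    σ ((y + (k.val * q : ℕ) : ℤ) : ZMod (m * q)) = glue (cellOf σ k) (cellOf σ (k + 1)) y := by
  have h5 : (((k.val : ℕ) : ℤ) : ZMod m) = k := by
    rw [Int.cast_natCast, ZMod.natCast_zmod_val]
  unfold glue
  split_ifs with h2 h3
  · have := intCast_eq_site (m := m) (k.val : ℤ) (⟨y.toNat, h2⟩ : Fin q)
    rw [h5] at this
    unfold cellOf
    rw [← this]
    congr 2
    push_cast
    rw [Int.toNat_of_nonneg h0]
    ring
  · have := intCast_eq_site (m := m) (k.val + 1 : ℤ) (⟨y.toNat - q, h3⟩ : Fin q)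
    have h6 : (((k.val : ℕ) + 1 : ℤ) : ZMod m) = k + 1 := by rw [Int.cast_add, h5, Int.cast_one]
    rw [h6] at this
    unfold cellOf
    rw [← this]
    push_cast [Nat.cast_sub (not_lt.1 h2)]
    have h4 : ((y.toNat : ℤ) : ZMod (m * q)) = (y : ZMod (m * q)) := by
      rw [Int.toNat_of_nonneg h0]
    push_cast at h4
    rw [h4]
    congr 1
    ring
  · omega

variable (A : Model m q)

namespace Model

/-- Translation invariance moves the sets with least element in any cell to the reference cell [0,
q), where `cellEnergy` and `bondEnergy` are defined. -/
theorem sum_translate (x : ℤ) (t : ℤ) (s : ℤ → Spin) :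
    ∑ X ∈ (Icc (x + t) (x + t + (A.S : ℤ))).powerset with x + t ∈ X, A.U X (fun y => s y)
      = ∑ X ∈ (Icc x (x + (A.S : ℤ))).powerset with x ∈ X, A.U X (fun y => s (y + t)) := by
  symm
  refine sum_nbij' (fun X => X.map (addRightEmbedding t)) (fun X => X.map (addRightEmbedding (-t)))
    ?_ ?_ ?_ ?_ ?_
  · intro X hX
    simp only [mem_filter, mem_powerset, subset_iff, mem_Icc, mem_map, addRightEmbedding_apply,
      forall_exists_index, and_imp, forall_apply_eq_imp_iff₂] at hX ⊢
    exact ⟨fun y hy => by have := hX.1 hy; omega, x, hX.2, rfl⟩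
  · intro X hX
    simp only [mem_filter, mem_powerset, subset_iff, mem_Icc, mem_map, addRightEmbedding_apply,
      forall_exists_index, and_imp, forall_apply_eq_imp_iff₂] at hX ⊢
    exact ⟨fun y hy => by have := hX.1 hy; omega, x + t, hX.2, by ring⟩
  · intro X _
    ext y
    simp
  · intro X _
    ext y
    simp
  · intro X _
    exact (A.U_transl X t s).symm

/-- The sets with least element in a cell are the sets in the cell and those which meet it and the
next cell. -/
theorem sum_least_eq (s : ℤ → Spin) :
    ∑ i : Fin q, ∑ X ∈ (Icc (i.val : ℤ) (i.val + (A.S : ℤ))).powerset with (i.val : ℤ) ∈ X,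
        A.U X (fun y => s y)
      = ∑ X ∈ (Ico (0 : ℤ) (2 * q)).powerset with ∃ x ∈ X, x < (q : ℤ), A.U X (fun y => s y) := by
  classical
  have hS := A.S_lt
  have h1 : ∀ i : Fin q, ∑ X ∈ (Icc (i.val : ℤ) (i.val + (A.S : ℤ))).powerset with (i.val : ℤ) ∈ X,
        A.U X (fun y => s y) = ∑ X ∈ (Ico (0 : ℤ) (2 * q)).powerset,
          if (i.val : ℤ) ∈ X ∧ X ⊆ Icc (i.val : ℤ) (i.val + (A.S : ℤ)) then A.U X (fun y => s y)
          else 0 := by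
    intro i
    rw [← sum_filter]
    refine sum_congr ?_ fun _ _ => rfl
    ext X
    simp only [mem_filter, mem_powerset]
    refine ⟨fun h => ⟨fun y hy => ?_, h.2, h.1⟩, fun h => ⟨h.2.2, h.2.1⟩⟩
    have h2 := mem_Icc.1 (h.1 hy)
    have h3 := i.isLt
    rw [mem_Ico]
    omega
  simp_rw [h1]
  rw [sum_comm, sum_filter]
  refine sum_congr rfl fun X hX => ?_
  rw [mem_powerset] at hX
  split_ifs with h
  · obtain ⟨x, hx, hxq⟩ := h
    have hne : X.Nonempty := ⟨x, hx⟩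
    have hmin := X.min'_mem hne
    have hminle : ∀ y ∈ X, X.min' hne ≤ y := fun y hy => X.min'_le y hy
    set μ := X.min' hne with hμ
    have hμ0 := mem_Ico.1 (hX hmin)
    have hμq : μ < q := (hminle x hx).trans_lt hxq
    -- A set of admissible diameter is counted exactly once, at i = min X; any other set has `U X =
    -- 0` by the finite range.
    by_cases hd : X ⊆ Icc μ (μ + (A.S : ℤ))
    · rw [sum_eq_single (⟨μ.toNat, by omega⟩ : Fin q)]
      · rw [if_pos]
        simp only [Int.toNat_of_nonneg hμ0.1]
        exact ⟨hmin, hd⟩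
      · intro i _ hi
        rw [if_neg]
        rintro ⟨h2, h3⟩
        apply hi
        have h4 := mem_Icc.1 (h3 hmin)
        have h5 := hminle _ h2
        ext
        simp only
        omega
      · simp
    · have hU : A.U X = 0 := by
        refine A.U_range X ?_
        simp only [subset_iff, mem_Icc, not_forall] at hd
        obtain ⟨y, hy, hy2⟩ := hd
        refine ⟨y, hy, μ, hmin, ?_⟩
        have := hminle y hy
        rw [abs_of_nonneg (by omega)]
        omega
      simp [hU]
  · refine sum_eq_zero fun i _ => if_neg ?_
    rintro ⟨h2, -⟩
    exact h ⟨_, h2, by exact_mod_cast i.isLt⟩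

/-- The sets are split according to whether they reach the second cell. Those which do not lie in
[0, q), where `glue τ τ'` and `glue τ τ` agree. -/
theorem sum_meet_eq (τ τ' : CellConf q) :
    ∑ X ∈ (Ico (0 : ℤ) (2 * q)).powerset with ∃ x ∈ X, x < (q : ℤ),
        A.U X (fun y => glue τ τ' y) = A.cellEnergy τ + A.bondEnergy τ τ' := by
  classical
  rw [← sum_filter_add_sum_filter_not _ (fun X => ∃ x ∈ X, (q : ℤ) ≤ x), add_comm]
  unfold cellEnergy bondEnergy
  congr 1
  · refine sum_congr ?_ ?_
    · ext X
      simp only [mem_filter, mem_powerset, subset_iff, mem_Ico]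
      constructor
      · rintro ⟨⟨h1, x, hx, -⟩, h2⟩
        push Not at h2
        exact ⟨fun y hy => ⟨(h1 hy).1, h2 y hy⟩, x, hx⟩
      · rintro ⟨h1, x, hx⟩
        refine ⟨⟨fun y hy => ?_, x, hx, (h1 hx).2⟩, ?_⟩
        · have := h1 hy
          omega
        · push Not
          exact fun y hy => (h1 hy).2
    · intro X hX
      simp only [mem_filter, mem_powerset, subset_iff, mem_Ico] at hX
      congr 1
      funext y
      have := hX.1 y.2
      have hy : (y : ℤ).toNat < q := by omega
      simp [glue, hy]
  · refine sum_congr ?_ fun _ _ => rfl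
    ext X
    simp only [mem_filter, mem_powerset, and_assoc]

/-- The short-range Hamiltonian is the sum of the energies of the cells and of the bonds. -/
theorem shortHamiltonian_eq [NeZero m] [NeZero q] (σ : Micro m q) :
    A.shortHamiltonian σ = ∑ k : ZMod m,
      (A.cellEnergy (cellOf σ k) + A.bondEnergy (cellOf σ k) (cellOf σ (k + 1))) := by
  unfold shortHamiltonian
  rw [sum_Ico_eq_sum_site]
  refine sum_congr rfl fun k _ => ?_
  have h1 := fun i : Fin q => A.sum_translate (i.val : ℤ) ((k.val * q : ℕ) : ℤ)
    (fun y => σ (y : ZMod (m * q)))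
  simp_rw [h1]
  rw [A.sum_least_eq (fun y => σ ((y + (k.val * q : ℕ) : ℤ) : ZMod (m * q))), ← sum_meet_eq]
  refine sum_congr rfl fun X hX => ?_
  simp only [mem_filter, mem_powerset, subset_iff, mem_Ico] at hX
  congr 1
  funext y
  exact spin_eq_glue σ k (hX.1 y.2).1 (hX.1 y.2).2

/-- Moving x to the origin makes the term comparable with `Potential.size`, which counts sets
containing 0. -/
theorem abs_U_le (X : Finset ℤ) (x : ℤ) (s : ℤ → Spin) :
    |A.U X (fun y => s y)| ≤ ‖A.U (X.map (addRightEmbedding (-x)))‖ := by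
  have h := A.U_transl X (-x) (fun z => s (z + x))
  simp only [neg_add_cancel_right] at h
  rw [← h, ← Real.norm_eq_abs]
  exact norm_le_pi_norm _ _

theorem size_nonneg (U : Potential) (S : ℕ) : 0 ≤ U.size S :=
  sum_nonneg fun _ _ => norm_nonneg _

/-- The interaction of two adjacent cells is bounded by `S ‖U‖`. -/
theorem abs_bondEnergy_le (τ τ' : CellConf q) :
    |A.bondEnergy τ τ'| ≤ A.S * A.U.size A.S := by
  classical
  have hS := A.S_lt
  unfold bondEnergy
  refine (abs_sum_le_sum_abs _ _).trans ?_
  set s : ℤ → Spin := glue τ τ' with hs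
  set D : Finset ℤ → Prop := fun X => ∀ x ∈ X, ∀ y ∈ X, |x - y| ≤ (A.S : ℤ) with hD
  -- A set of diameter at most S that crosses the boundary must contain one of the last S sites of
  -- the left cell. Summing over that site gives the factor S.
  set I : Finset ℤ := Ico ((q : ℤ) - A.S) q with hI
  have hcard : (I.card : ℝ) = A.S := by
    rw [hI, Int.card_Ico]
    simp
  have h1 : ∀ X ∈ (Ico (0 : ℤ) (2 * q)).powerset.filter
      (fun X => (∃ x ∈ X, x < (q : ℤ)) ∧ ∃ x ∈ X, (q : ℤ) ≤ x),
      |A.U X (fun y => s y)| ≤ ∑ x ∈ I, if x ∈ X ∧ D X then |A.U X (fun y => s y)| else 0 := by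
    intro X hX
    obtain ⟨-, ⟨x, hx, hxq⟩, y, hy, hyq⟩ := mem_filter.1 hX
    by_cases hd : D X
    · have hxI : x ∈ I := by
        have := (abs_le.1 (hd y hy x hx)).2
        rw [hI, mem_Ico]
        omega
      refine le_trans ?_ (single_le_sum (f := fun x => if x ∈ X ∧ D X then
        |A.U X (fun y => s y)| else 0) (fun z _ => ?_) hxI)
      · simp [hx, hd]
      · split_ifs
        · exact abs_nonneg _
        · exact le_rfl
    · have hU : A.U X = 0 := by
        refine A.U_range X ?_
        simp only [hD] at hd
        push Not at hd
        exact hd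
      simp [hU]
  refine (sum_le_sum h1).trans ?_
  rw [sum_comm, ← hcard, ← nsmul_eq_mul]
  refine sum_le_card_nsmul _ _ _ fun x _ => ?_
  rw [← sum_filter]
  have hinj : Function.Injective (fun X : Finset ℤ => X.map (addRightEmbedding (-x))) :=
    map_injective _
  refine (sum_le_sum fun X _ => A.abs_U_le X x s).trans ?_
  rw [← sum_image (f := fun Y => ‖A.U Y‖) hinj.injOn]
  refine sum_le_sum_of_subset_of_nonneg ?_ fun _ _ _ => norm_nonneg _
  intro Y hY
  obtain ⟨X, hX, rfl⟩ := mem_image.1 hY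
  obtain ⟨-, hxX, hd⟩ := mem_filter.1 hX
  simp only [mem_filter, mem_powerset, subset_iff, mem_Icc, mem_map, addRightEmbedding_apply,
      forall_exists_index, and_imp, forall_apply_eq_imp_iff₂]
  refine ⟨fun y hy => ?_, ⟨x, hxX, by ring⟩, fun y hy z hz => ?_⟩
  · have := abs_le.1 (hd y hy x hxX)
    omega
  · have := hd y hy z hz
    rwa [add_sub_add_right_eq_sub]

end Model

end ShortRange

/-! ### The long-range interaction -/

section LongRange

open Finset

/-- A symmetric double sum in terms of the ordered pairs. -/
theorem sum_pairs_eq {m : ℕ} [NeZero m] {D : ZMod m → ZMod m → ℝ} (hD : ∀ k l, D k l = D l k) :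
    ∑ p : ZMod m × ZMod m with p.1.val ≤ p.2.val, D p.1 p.2 * (2 - if p.1 = p.2 then 1 else 0)
      = ∑ k, ∑ l, D k l := by
  -- The weight 2 - δ counts the pairs with ≤ once and those with < once more; reflecting the second
  -- family completes the square.
  have h1 : ∑ p : ZMod m × ZMod m with p.1.val ≤ p.2.val,
        D p.1 p.2 * (2 - if p.1 = p.2 then 1 else 0)
      = ∑ p : ZMod m × ZMod m, (if p.1.val ≤ p.2.val then D p.1 p.2 else 0)
        + ∑ p : ZMod m × ZMod m, (if p.1.val < p.2.val then D p.1 p.2 else 0) := by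
    rw [sum_filter, ← sum_add_distrib]
    refine sum_congr rfl fun p _ => ?_
    rcases lt_trichotomy p.1.val p.2.val with h | h | h
    · have : p.1 ≠ p.2 := fun hh => by rw [hh] at h; exact lt_irrefl _ h
      rw [if_pos h.le, if_pos h.le, if_pos h, if_neg this]
      ring
    · have := ZMod.val_injective m h
      rw [if_pos h.le, if_pos h.le, if_neg h.not_lt, if_pos this]
      ring
    · rw [if_neg (not_le.2 h), if_neg (not_le.2 h), if_neg (not_lt.2 h.le), add_zero]
  have h2 : ∑ p : ZMod m × ZMod m, (if p.1.val < p.2.val then D p.1 p.2 else 0)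
      = ∑ p : ZMod m × ZMod m, (if p.2.val < p.1.val then D p.1 p.2 else 0) := by
    rw [← (Equiv.prodComm (ZMod m) (ZMod m)).sum_comp]
    refine sum_congr rfl fun p _ => ?_
    simp only [Equiv.prodComm_apply, Prod.fst_swap, Prod.snd_swap, hD p.2 p.1]
  rw [h1, h2, ← sum_add_distrib, ← Fintype.sum_prod_type']
  refine sum_congr rfl fun p _ => ?_
  rcases le_or_gt p.1.val p.2.val with h | h
  · rw [if_pos h, if_neg (not_lt.2 h), add_zero]
  · rw [if_neg (not_le.2 h), if_pos h, zero_add]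

variable {m q : ℕ} (A : Model m q)

theorem spin_mul_self (u : Spin) : ((u : ℤ) : ℝ) * ((u : ℤ) : ℝ) = 1 := by
  rcases Int.units_eq_one_or u with h | h <;> simp [h]

theorem abs_spin (u : Spin) : |((u : ℤ) : ℝ)| = 1 := by
  rcases Int.units_eq_one_or u with h | h <;> simp [h]

theorem sum_spin_site (σ : Micro m q) (k : ZMod m) :
    ∑ i : Fin q, ((σ (site k i) : ℤ) : ℝ) = coarseMap σ k := by
  simp [coarseMap, blockSpin, cellOf]

namespace Model

theorem J_neg [NeZero m] [NeZero q] (x : Site m q) : A.J (-x) = A.J x := by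
  unfold J
  rw [← Int.cast_abs, ← Int.cast_abs, Int.abs_eq_natAbs, Int.abs_eq_natAbs,
    ZMod.natAbs_valMinAbs_neg]

theorem Jbar_comm [NeZero m] [NeZero q] (k l : ZMod m) : A.Jbar k l = A.Jbar l k := by
  by_cases h : k = l
  · rw [h]
  · unfold Jbar
    rw [if_neg h, if_neg (Ne.symm h), sum_comm]
    congr 1
    refine sum_congr rfl fun i _ => sum_congr rfl fun j _ => ?_
    rw [← J_neg, neg_sub]

/-- The error made in the interaction of two cells, for ordered pairs of cells. -/
def pairError (σ : Micro m q) (k l : ZMod m) : ℝ :=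
  ∑ i : Fin q, ∑ j : Fin q with site l j ≠ site k i,
    (A.J (site k i - site l j) - A.Jbar k l) * (σ (site k i) : ℤ) * (σ (site l j) : ℤ)

theorem pairError_comm [NeZero m] [NeZero q] (σ : Micro m q) (k l : ZMod m) :
    A.pairError σ k l = A.pairError σ l k := by
  unfold pairError
  simp_rw [sum_filter]
  rw [sum_comm]
  refine sum_congr rfl fun i _ => sum_congr rfl fun j _ => ?_
  rw [← J_neg, neg_sub, A.Jbar_comm k l]
  by_cases h : site l i = (site k j : Site m q)
  · simp [h]
  · rw [if_pos h, if_pos (Ne.symm h)]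
    ring

theorem longError_eq (σ : Micro m q) (k l : ZMod m) :
    A.longError k l σ = -(1 / 2) * (A.pairError σ k l * (2 - if k = l then 1 else 0)) := by
  unfold longError pairError
  rw [sum_mul]
  simp_rw [sum_mul]

/-- With constant coefficients the double sum is a product of block spins. Inside one cell the
diagonal is removed, and each of its q terms equals `Jbar` since σ(x)² = 1; this is the origin of
-q. -/
theorem sum_Jbar_eq [NeZero m] [NeZero q] (σ : Micro m q) (k l : ZMod m) :
    ∑ i : Fin q, ∑ j : Fin q with site l j ≠ site k i,
        A.Jbar k l * (σ (site k i) : ℤ) * (σ (site l j) : ℤ)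
      = (if l ≠ k then A.Jbar k l * coarseMap σ k * coarseMap σ l else 0)
        + if l = k then A.Jbar k k * ((coarseMap σ k : ℝ) ^ 2 - q) else 0 := by
  have h0 : ∑ i : Fin q, ∑ j : Fin q,
      A.Jbar k l * (σ (site k i) : ℤ) * (σ (site l j) : ℤ)
      = A.Jbar k l * coarseMap σ k * coarseMap σ l := by
    rw [← sum_spin_site σ k, ← sum_spin_site σ l, mul_assoc, sum_mul_sum, mul_sum]
    refine sum_congr rfl fun i _ => ?_
    rw [mul_sum]
    exact sum_congr rfl fun j _ => by ring
  by_cases h : l = k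
  · subst h
    simp only [ne_eq, not_true_eq_false, if_false, if_true, zero_add, site_inj, true_and]
    have h1 : ∀ i : Fin q, ∑ j : Fin q with j ≠ i,
        A.Jbar l l * (σ (site l i) : ℤ) * (σ (site l j) : ℤ)
        = ∑ j : Fin q, A.Jbar l l * (σ (site l i) : ℤ) * (σ (site l j) : ℤ) - A.Jbar l l := by
      intro i
      rw [← add_sum_erase _ _ (mem_univ i), filter_ne', mul_assoc, spin_mul_self]
      ring
    simp only [ne_eq] at h1
    simp_rw [h1, sum_sub_distrib, h0]
    simp
    ring
  · have h' : ¬ k = l := fun hh => h hh.symm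
    simp only [ne_eq, h, not_false_eq_true, if_true, if_false, add_zero, site_inj, false_and]
    simp only [filter_true, h0]

/-- The long-range Hamiltonian is the sum of its first approximation and of the errors. -/
theorem longHamiltonian_eq [NeZero m] [NeZero q] (σ : Micro m q) :
    A.longHamiltonian σ = A.longCoarse (coarseMap σ)
      + ∑ p : ZMod m × ZMod m with p.1.val ≤ p.2.val, A.longError p.1 p.2 σ := by
  simp_rw [longError_eq]
  rw [← mul_sum, sum_pairs_eq (A.pairError_comm σ)]
  have h1 : ∀ k l, A.pairError σ k l
      = (∑ i : Fin q, ∑ j : Fin q with site l j ≠ site k i,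
          A.J (site k i - site l j) * (σ (site k i) : ℤ) * (σ (site l j) : ℤ))
        - ((if l ≠ k then A.Jbar k l * coarseMap σ k * coarseMap σ l else 0)
        + if l = k then A.Jbar k k * ((coarseMap σ k : ℝ) ^ 2 - q) else 0) := by
    intro k l
    rw [← sum_Jbar_eq]
    unfold pairError
    simp_rw [sub_mul, sum_sub_distrib]
  have h2 : A.longHamiltonian σ = -(1 / 2) * ∑ k : ZMod m, ∑ l : ZMod m,
      ∑ i : Fin q, ∑ j : Fin q with site l j ≠ site k i,
          A.J (site k i - site l j) * (σ (site k i) : ℤ) * (σ (site l j) : ℤ) := by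
    unfold longHamiltonian
    congr 1
    rw [sum_site]
    refine sum_congr rfl fun k _ => ?_
    rw [sum_comm (s := univ) (t := univ)]
    refine sum_congr rfl fun i _ => ?_
    rw [sum_filter, sum_site]
    refine sum_congr rfl fun l _ => ?_
    rw [sum_filter]
  rw [h2]
  simp_rw [h1, sum_sub_distrib, sum_add_distrib, sum_ite_eq']
  unfold longCoarse
  simp only [sum_filter, mem_univ, if_true]
  ring

theorem longError_congr {σ σ' : Micro m q} {k l : ZMod m} (hk : cellOf σ k = cellOf σ' k)
    (hl : cellOf σ l = cellOf σ' l) : A.longError k l σ = A.longError k l σ' := by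
  have h1 : ∀ i, σ (site k i) = σ' (site k i) := fun i => congrFun hk i
  have h2 : ∀ i, σ (site l i) = σ' (site l i) := fun i => congrFun hl i
  unfold longError
  simp_rw [h1, h2]

/-- V' is continuous on [0, 1] and vanishes beyond 1. Boundedness is what makes the real supremum in
`gradNorm` an upper bound and not a default value. -/
theorem bddAbove_derivWithin :
    BddAbove (Set.range fun r : Set.Ici (0 : ℝ) => |derivWithin A.V (Set.Ici 0) r|) := by
  have hcont := A.V_smooth.continuousOn_derivWithin (uniqueDiffOn_Ici 0) le_rfl
  obtain ⟨b, hb⟩ := (isCompact_Icc (a := (0 : ℝ)) (b := 1)).exists_bound_of_continuousOn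
    (hcont.mono Set.Icc_subset_Ici_self)
  refine ⟨b, ?_⟩
  rintro _ ⟨⟨r, hr⟩, rfl⟩
  by_cases h : r ≤ 1
  · exact hb r ⟨hr, h⟩
  · have h0 : A.V =ᶠ[nhdsWithin r (Set.Ici 0)] fun _ => 0 := by
      refine nhdsWithin_le_nhds ?_
      filter_upwards [lt_mem_nhds (not_le.1 h)] with x hx using A.V_support x hx
    have h1 : derivWithin A.V (Set.Ici 0) r = 0 := by
      rw [h0.derivWithin_eq (A.V_support r (not_le.1 h))]
      simp
    simp only [h1, abs_zero]
    exact (norm_nonneg _).trans (hb 0 ⟨le_rfl, zero_le_one⟩)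

theorem gradNorm_nonneg : 0 ≤ A.gradNorm := Real.iSup_nonneg fun _ => abs_nonneg _

theorem abs_V_sub_le {r s : ℝ} (hr : 0 ≤ r) (hs : 0 ≤ s) :
    |A.V r - A.V s| ≤ A.gradNorm * |r - s| :=
  (convex_Ici (0 : ℝ)).norm_image_sub_le_of_norm_derivWithin_le
    (A.V_smooth.differentiableOn one_ne_zero)
    (fun x hx => le_ciSup A.bddAbove_derivWithin ⟨x, hx⟩) hs hr

end Model

/-- The periodic distance to 0 is 1-Lipschitz, since `valMinAbs` has the least absolute value in its
residue class. -/
theorem abs_valMinAbs_sub_le {n : ℕ} [NeZero n] (x y : ZMod n) (z : ℤ) (h : x = y + z) :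
    |(|(x.valMinAbs : ℝ)| - |(y.valMinAbs : ℝ)|)| ≤ |(z : ℝ)| := by
  have key : ∀ (x y : ZMod n) (z : ℤ), x = y + z → |x.valMinAbs| ≤ |y.valMinAbs| + |z| := by
    intro x y z h
    have h1 := ZMod.natAbs_valMinAbs_add_le y (z : ZMod n)
    rw [← h] at h1
    have h2 : (z : ZMod n).valMinAbs.natAbs ≤ z.natAbs :=
      ZMod.natAbs_min_of_le_div_two n _ _ (ZMod.coe_valMinAbs _) (ZMod.natAbs_valMinAbs_le _)
    have h3 := Int.natAbs_add_le y.valMinAbs (z : ZMod n).valMinAbs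
    simp only [Int.abs_eq_natAbs]
    exact_mod_cast h1.trans (h3.trans (by omega))
  have h1 := key x y z h
  have h2 := key y x (-z) (by rw [h]; push_cast; ring)
  rw [abs_neg] at h2
  rw [abs_le]
  constructor
  · have : |(y.valMinAbs : ℝ)| ≤ |(x.valMinAbs : ℝ)| + |(z : ℝ)| := by exact_mod_cast h2
    linarith
  · have : |(x.valMinAbs : ℝ)| ≤ |(y.valMinAbs : ℝ)| + |(z : ℝ)| := by exact_mod_cast h1
    linarith

/-! ### Oscillation and reach of the long-range interaction. -/

namespace Model

theorem L_pos : 0 < A.L := (Nat.cast_nonneg q).trans_lt A.lt_L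

/-- The variation of the interaction of the sites in two cells. -/
theorem abs_J_sub_le [NeZero m] [NeZero q] (k l : ZMod m) (i j i' j' : Fin q) :
    |A.J (site k i - site l j) - A.J (site k i' - site l j')|
      ≤ A.gradNorm * (2 * q) / A.L ^ 2 := by
  have hL := A.L_pos
  set x : Site m q := site k i - site l j with hx
  set y : Site m q := site k i' - site l j' with hy
  have hxy : x = y + (((i : ℤ) - i' - j + j' : ℤ) : Site m q) := by
    rw [hx, hy]
    unfold site
    push_cast
    ring
  have h1 := abs_valMinAbs_sub_le x y _ hxy
  have h2 : |(((i : ℤ) - i' - j + j' : ℤ) : ℝ)| ≤ 2 * q := by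
    rw [← Int.cast_abs]
    have : |(i : ℤ) - i' - j + j'| ≤ 2 * q := by
      rw [abs_le]
      omega
    exact_mod_cast this
  unfold J
  rw [← mul_sub, abs_mul, abs_of_pos (by positivity)]
  have h3 := A.abs_V_sub_le (r := |(x.valMinAbs : ℝ)| / A.L) (s := |(y.valMinAbs : ℝ)| / A.L)
    (by positivity) (by positivity)
  rw [← sub_div, abs_div, abs_of_pos hL] at h3
  calc 1 / A.L * |A.V (|(x.valMinAbs : ℝ)| / A.L) - A.V (|(y.valMinAbs : ℝ)| / A.L)|
      ≤ 1 / A.L * (A.gradNorm * ((2 * q) / A.L)) := by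
        refine mul_le_mul_of_nonneg_left (h3.trans ?_) (by positivity)
        refine mul_le_mul_of_nonneg_left ?_ A.gradNorm_nonneg
        exact div_le_div_of_nonneg_right (h1.trans h2) hL.le
    _ = _ := by
        field_simp

/-- `Jbar` is an average of values of J between the same two cells, each within the oscillation
bound `abs_J_sub_le` of the given one. -/
theorem abs_J_sub_Jbar_le [NeZero m] [NeZero q] (k l : ZMod m) (i j : Fin q)
    (h : (site l j : Site m q) ≠ site k i) :
    |A.J (site k i - site l j) - A.Jbar k l| ≤ A.gradNorm * (2 * q) / A.L ^ 2 := by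
  have hq : (0 : ℝ) < q := Nat.cast_pos.2 (Nat.pos_of_neZero q)
  have hJ := A.abs_J_sub_le k l i j
  set a := A.gradNorm * (2 * q) / A.L ^ 2
  set x := A.J (site k i - site l j) with hx
  unfold Jbar
  split_ifs with hkl
  · subst hkl
    have hij : j ≠ i := fun hh => h (by rw [hh])
    have hq1 : (1 : ℝ) < q := by
      have h1 := i.isLt
      have h2 := j.isLt
      have h3 : (j : ℕ) ≠ i := fun hh => hij (Fin.ext hh)
      have : 1 < q := by omega
      exact_mod_cast this
    have hN : 0 < (q : ℝ) * (q - 1) := mul_pos hq (by linarith)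
    have hq1' : (q : ℝ) - 1 ≠ 0 := by linarith
    have hcard : ∀ c : ℝ, ∑ i : Fin q, ∑ j : Fin q with j ≠ i, c = q * (q - 1) * c := by
      intro c
      simp only [sum_const, filter_ne', card_erase_of_mem (mem_univ _), card_univ, Fintype.card_fin,
        nsmul_eq_mul, Nat.cast_sub (Nat.pos_of_neZero q : 1 ≤ q), Nat.cast_one, mul_assoc]
    have e : x - 1 / ((q : ℝ) * (q - 1)) * ∑ i : Fin q, ∑ j : Fin q with j ≠ i,
        A.J (site k i - site k j)
        = 1 / ((q : ℝ) * (q - 1)) * ∑ i : Fin q, ∑ j : Fin q with j ≠ i,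
        (x - A.J (site k i - site k j)) := by
      simp_rw [sum_sub_distrib]
      rw [hcard, mul_sub]
      field_simp
    rw [e, abs_mul, abs_of_pos (by positivity)]
    calc _ ≤ 1 / ((q : ℝ) * (q - 1)) * ∑ i : Fin q, ∑ j : Fin q with j ≠ i, a := by
          refine mul_le_mul_of_nonneg_left ?_ (by positivity)
          exact (abs_sum_le_sum_abs _ _).trans (sum_le_sum fun _ _ =>
            (abs_sum_le_sum_abs _ _).trans (sum_le_sum fun _ _ => hJ _ _))
      _ = a := by
          rw [hcard]
          field_simp
  · have e : x - 1 / (q : ℝ) ^ 2 * ∑ i : Fin q, ∑ j : Fin q, A.J (site k i - site l j)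
        = 1 / (q : ℝ) ^ 2 * ∑ i : Fin q, ∑ j : Fin q, (x - A.J (site k i - site l j)) := by
      simp_rw [sum_sub_distrib]
      simp only [sum_const, card_univ, Fintype.card_fin, nsmul_eq_mul]
      field_simp
    rw [e, abs_mul, abs_of_pos (by positivity)]
    calc _ ≤ 1 / (q : ℝ) ^ 2 * ∑ i : Fin q, ∑ j : Fin q, a := by
          refine mul_le_mul_of_nonneg_left ?_ (by positivity)
          exact (abs_sum_le_sum_abs _ _).trans (sum_le_sum fun _ _ =>
            (abs_sum_le_sum_abs _ _).trans (sum_le_sum fun _ _ => hJ _ _))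
      _ = a := by
          simp only [sum_const, card_univ, Fintype.card_fin, nsmul_eq_mul]
          field_simp

/-- Two cells which interact with each other. -/
def Near (k l : ZMod m) : Prop :=
  ∃ i j : Fin q, |((site k i - site l j : Site m q).valMinAbs : ℝ)| ≤ A.L

theorem near_comm [NeZero m] [NeZero q] {k l : ZMod m} : A.Near k l ↔ A.Near l k := by
  have : ∀ k l, A.Near k l → A.Near l k := by
    rintro k l ⟨i, j, h⟩
    refine ⟨j, i, ?_⟩
    rw [← neg_sub]
    rw [← Int.cast_abs, Int.abs_eq_natAbs] at h ⊢
    rwa [ZMod.natAbs_valMinAbs_neg]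
  exact ⟨this k l, this l k⟩

open Classical in
/-- A bound of the error made in the interaction of two cells, times `β`. -/
def longBound (k l : ZMod m) : ℝ :=
  if A.Near k l then A.β * ((q : ℝ) ^ 2 * (A.gradNorm * (2 * q) / A.L ^ 2)) else 0

theorem longBound_nonneg (k l : ZMod m) : 0 ≤ A.longBound k l := by
  unfold longBound
  have := A.β_pos.le
  have := A.gradNorm_nonneg
  split_ifs <;> positivity

theorem longBound_comm [NeZero m] [NeZero q] (k l : ZMod m) :
    A.longBound k l = A.longBound l k := by
  unfold longBound
  by_cases h : A.Near k l
  · rw [if_pos h, if_pos (A.near_comm.1 h)]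
  · rw [if_neg h, if_neg fun hh => h (A.near_comm.1 hh)]

theorem J_eq_zero {x : Site m q} (hx : A.L < |(x.valMinAbs : ℝ)|) : A.J x = 0 := by
  unfold J
  rw [A.V_support _ ((one_lt_div A.L_pos).2 hx), mul_zero]

theorem abs_longError_le [NeZero m] [NeZero q] (k l : ZMod m) (σ : Micro m q) :
    |-A.β * A.longError k l σ| ≤ A.longBound k l := by
  have hβ := A.β_pos
  rw [abs_mul, abs_neg, abs_of_pos hβ]
  unfold longBound
  split_ifs with h
  · refine mul_le_mul_of_nonneg_left ?_ hβ.le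
    set a := A.gradNorm * (2 * q) / A.L ^ 2 with ha
    have ha0 : 0 ≤ a := by
      have := A.gradNorm_nonneg
      positivity
    have h1 : |A.pairError σ k l| ≤ (q : ℝ) ^ 2 * a := by
      have : ∑ i : Fin q, ∑ j : Fin q, a = (q : ℝ) ^ 2 * a := by
        simp only [sum_const, card_univ, Fintype.card_fin, nsmul_eq_mul]
        ring
      rw [← this]
      refine (abs_sum_le_sum_abs _ _).trans (sum_le_sum fun i _ => ?_)
      refine (abs_sum_le_sum_abs _ _).trans ?_
      rw [sum_filter]
      refine sum_le_sum fun j _ => ?_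
      split_ifs with hij
      · rw [abs_mul, abs_mul, abs_spin, abs_spin, mul_one, mul_one]
        exact A.abs_J_sub_Jbar_le k l i j hij
      · exact ha0
    -- The prefactor ½(2 - δ) is at most 1.
    rw [longError_eq, abs_mul, abs_mul]
    have h2 : |(2 - if k = l then 1 else 0 : ℝ)| ≤ 2 := by
      split_ifs <;> norm_num
    have h3 : |(-(1 / 2) : ℝ)| = 1 / 2 := by norm_num
    rw [h3]
    nlinarith [abs_nonneg (A.pairError σ k l)]
  · have hJ : ∀ i j : Fin q, A.J (site k i - site l j) = 0 := by
      intro i j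
      refine A.J_eq_zero (not_le.1 fun hh => h ⟨i, j, hh⟩)
    have hJb : A.Jbar k l = 0 := by
      unfold Jbar
      split_ifs with hkl
      · subst hkl
        simp [hJ]
      · simp [hJ]
    have : A.pairError σ k l = 0 := by
      simp [pairError, hJ, hJb]
    simp [longError_eq, this]

open Classical in
-- A cell within distance L is displaced by at most R = ⌊L⌋/q + 1 cells (integer division). This
-- leaves 2R + 1 ≤ 2L/q + 3 candidates, at most 5L/q because q < L.
theorem card_near_le [NeZero m] [NeZero q] (k : ZMod m) :
    ((univ.filter fun l => A.Near k l).card : ℝ) ≤ 5 * A.L / q := by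
  have hq : 0 < q := Nat.pos_of_neZero q
  have hq' : (0 : ℝ) < q := Nat.cast_pos.2 hq
  have hL := A.L_pos
  set N := ⌊A.L⌋₊ with hN
  set R := N / q + 1 with hR
  have hsub : (univ.filter fun l => A.Near k l)
      ⊆ (Icc (-(R : ℤ)) R).image fun t : ℤ => k + (t : ZMod m) := by
    intro l hl
    obtain ⟨i, j, hij⟩ := (mem_filter.1 hl).2
    set z := (site k i - site l j : Site m q).valMinAbs with hz
    have hzc : (z : Site m q) = site k i - site l j := ZMod.coe_valMinAbs _
    have hzN : |z| ≤ N := by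
      have : (z.natAbs : ℝ) ≤ A.L := by
        rw [Nat.cast_natAbs, Int.cast_abs]
        exact hij
      have := Nat.le_floor this
      rw [Int.abs_eq_natAbs]
      exact_mod_cast this
    have hzN' := abs_le.1 hzN
    -- y is the position of the site of `C_l` relative to the start of `C_k`: its quotient by q is
    -- the displacement of the cell, its remainder the position in that cell.
    set y : ℤ := i.val - z with hy
    have hqz : (0 : ℤ) < q := by exact_mod_cast hq
    have hr0 := Int.emod_nonneg y hqz.ne'
    have hrq := Int.emod_lt_of_pos y hqz
    have hdm := Int.emod_add_mul_ediv y q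
    have hsite : (site l j : Site m q)
        = site (k + ((y / q : ℤ) : ZMod m)) (⟨(y % q).toNat, by omega⟩ : Fin q) := by
      have e1 : (((k.val : ℤ) + y / q : ℤ) : ZMod m) = k + ((y / q : ℤ) : ZMod m) := by
        rw [Int.cast_add, Int.cast_natCast, ZMod.natCast_zmod_val]
      rw [← e1, ← intCast_eq_site]
      have e2 : ((k.val : ℤ) + y / q) * q + ((y % q).toNat : ℤ)
          = (k.val * q + i.val : ℕ) - z := by
        rw [Int.toNat_of_nonneg hr0]
        push_cast
        linear_combination hdm
      simp only [e2]
      rw [Int.cast_sub, hzc, Int.cast_natCast]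
      have e3 : (((k.val * q + i.val : ℕ)) : Site m q) = site k i := rfl
      rw [e3]
      ring
    have hl := (site_inj.1 hsite).1
    refine mem_image.2 ⟨y / q, mem_Icc.2 ?_, hl.symm⟩
    have hi := i.isLt
    have hNq : (N : ℤ) < R * q := by
      have := Nat.lt_div_mul_add (a := N) hq
      have h2 : R * q = N / q * q + q := by rw [hR]; ring
      exact_mod_cast h2 ▸ this
    constructor
    · rw [Int.le_ediv_iff_mul_le hqz]
      linarith [hzN'.1, hzN'.2, Int.natCast_nonneg i.val]
    · rw [← Int.lt_add_one_iff, Int.ediv_lt_iff_lt_mul hqz]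
      have : (i.val : ℤ) < q := by exact_mod_cast hi
      linarith [hzN'.1, hzN'.2]
  have hcard := (card_le_card hsub).trans card_image_le
  rw [Int.card_Icc] at hcard
  have h1 : (univ.filter fun l => A.Near k l).card ≤ 2 * (N / q) + 3 := by omega
  have h2 : ((N / q : ℕ) : ℝ) ≤ A.L / q :=
    Nat.cast_div_le.trans (div_le_div_of_nonneg_right (Nat.floor_le hL.le) hq'.le)
  have h3 : 1 ≤ A.L / q := (one_le_div hq').2 A.lt_L.le
  have h4 : ((univ.filter fun l => A.Near k l).card : ℝ) ≤ 2 * ((N / q : ℕ) : ℝ) + 3 := by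
    exact_mod_cast h1
  rw [mul_div_assoc]
  linarith

/-- At most 5L/q neighbours, each with bound 2βq³‖∇V‖/L². Although a cell has many long-range bonds,
their total effect is of order qδ. -/
theorem sum_longBound_le [NeZero m] [NeZero q] (k : ZMod m) :
    ∑ l, A.longBound k l ≤ 10 * (A.β * q ^ 2 * A.gradNorm / A.L) := by
  classical
  have hq' : (0 : ℝ) < q := Nat.cast_pos.2 (Nat.pos_of_neZero q)
  have hL := A.L_pos
  have hβ := A.β_pos
  have hG := A.gradNorm_nonneg
  unfold longBound
  rw [← sum_filter, sum_const, nsmul_eq_mul]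
  refine (mul_le_mul_of_nonneg_right (A.card_near_le k) (by positivity)).trans_eq ?_
  field_simp
  ring

end Model

end LongRange

/-! ### The reference measure as a directed product over the cells -/

section ReferenceMeasure

open Finset

variable {m q : ℕ}

/-- Evenness of m makes the parity alternate also across the periodic boundary, from m - 1 to 0. -/
theorem odd_val_add_one [NeZero m] (hm : Even m) (k : ZMod m) :
    Odd (k + 1).val ↔ ¬ Odd k.val := by
  have h0 : 0 < m := Nat.pos_of_neZero m
  obtain ⟨r, hr⟩ := hm
  have h1 : (1 : ZMod m).val = 1 := by
    have := ZMod.val_one'' (n := m) (by omega)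
    exact this
  have hk := ZMod.val_lt k
  rw [ZMod.val_add, h1, Nat.not_odd_iff_even, Nat.odd_iff, Nat.even_iff]
  by_cases h : k.val + 1 < m
  · rw [Nat.mod_eq_of_lt h]
    omega
  · have h2 : k.val + 1 = m := by omega
    rw [h2, Nat.mod_self]
    omega

theorem odd_val_sub_one [NeZero m] (hm : Even m) (k : ZMod m) :
    Odd (k - 1).val ↔ ¬ Odd k.val := by
  have := odd_val_add_one hm (k - 1)
  rw [sub_add_cancel] at this
  tauto

theorem prod_even_eq [NeZero m] (hm : Even m) (f : ZMod m → ℝ) :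
    ∏ k : ZMod m with Even k.val, f k = ∏ k : ZMod m with Odd k.val, f (k - 1) := by
  refine prod_nbij' (fun k => k + 1) (fun k => k - 1) ?_ ?_ ?_ ?_ ?_
  · intro k hk
    simpa [odd_val_add_one hm] using hk
  · intro k hk
    have := (odd_val_sub_one hm k).not
    simp only [mem_filter, mem_univ, true_and] at hk ⊢
    rw [← Nat.not_odd_iff_even]
    tauto
  all_goals simp

theorem prod_even_eq' [NeZero m] (hm : Even m) (f : ZMod m → ℝ) :
    ∏ k : ZMod m with Even k.val, f k = ∏ k : ZMod m with Odd k.val, f (k + 1) := by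
  refine prod_nbij' (fun k => k - 1) (fun k => k + 1) ?_ ?_ ?_ ?_ ?_
  · intro k hk
    simpa [odd_val_sub_one hm] using hk
  · intro k hk
    have := (odd_val_add_one hm k).not
    simp only [mem_filter, mem_univ, true_and] at hk ⊢
    rw [← Nat.not_odd_iff_even]
    tauto
  all_goals simp

theorem prod_odd_mul_prod_even [NeZero m] (f : ZMod m → ℝ) :
    (∏ k : ZMod m with Odd k.val, f k) * ∏ k : ZMod m with Even k.val, f k = ∏ k, f k := by
  rw [← prod_filter_mul_prod_filter_not univ (fun k : ZMod m => Odd k.val)]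
  simp_rw [Nat.not_odd_iff_even]

/-- The sites, as positions in cells. -/
def siteEquiv (m q : ℕ) [NeZero m] [NeZero q] : ZMod m × Fin q ≃ Site m q :=
  Equiv.ofBijective (fun p => site p.1 p.2) (by
    rw [Fintype.bijective_iff_injective_and_card]
    refine ⟨fun a b h => Prod.ext_iff.2 (site_inj.1 h), ?_⟩
    simp [ZMod.card])

/-- Microscopic configurations, as families of configurations of the cells. -/
def cellEquiv (m q : ℕ) [NeZero m] [NeZero q] : Micro m q ≃ (ZMod m → CellConf q) :=
  (Equiv.arrowCongr (siteEquiv m q).symm (Equiv.refl Spin)).trans (Equiv.curry _ _ _)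

theorem cellEquiv_apply [NeZero m] [NeZero q] (σ : Micro m q) :
    cellEquiv m q σ = cellOf σ := rfl

theorem cellOf_symm [NeZero m] [NeZero q] (ω : ZMod m → CellConf q) :
    cellOf ((cellEquiv m q).symm ω) = ω := by
  rw [← cellEquiv_apply, Equiv.apply_symm_apply]

/-! ### Conditional priors and partition functions as finite sums. -/

namespace Model

variable (A : Model m q)

instance [NeZero m] [NeZero q] : IsProbabilityMeasure A.prior := by
  have := A.P_prob
  unfold prior
  infer_instance

instance (k : ZMod m) : IsProbabilityMeasure (A.cellPrior k) := by
  have := A.P_prob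
  unfold cellPrior
  infer_instance

theorem measurePreserving_cellEquiv [NeZero m] [NeZero q] :
    MeasurePreserving (cellEquiv m q) A.prior (Measure.pi A.cellPrior) := by
  have := A.P_prob
  refine ⟨measurable_of_finite _, Measure.ext_of_singleton fun ω => ?_⟩
  have h : cellEquiv m q ⁻¹' {ω} = {(cellEquiv m q).symm ω} := by
    ext σ
    simp [Equiv.eq_symm_apply]
  rw [Measure.map_apply (measurable_of_finite _) (measurableSet_singleton _), h,
    Measure.pi_singleton]
  unfold prior
  rw [Measure.pi_singleton, ← (siteEquiv m q).prod_comp, Fintype.prod_prod_type]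
  refine prod_congr rfl fun k _ => ?_
  unfold cellPrior
  rw [Measure.pi_singleton]
  refine prod_congr rfl fun i _ => ?_
  rw [← congrFun (congrFun (cellOf_symm ω) k) i]
  rfl

theorem prior_fiber [NeZero m] [NeZero q] (η : Coarse m) :
    A.prior {σ | coarseMap σ = η} = ∏ k, A.cellPrior k {τ | blockSpin τ = η k} := by
  rw [← Measure.pi_pi, ← A.measurePreserving_cellEquiv.measure_preimage
    (MeasurableSet.of_discrete).nullMeasurableSet]
  congr 1
  ext σ
  simp [funext_iff, cellEquiv_apply, coarseMap]

theorem cellPrior_ne_zero [NeZero m] [NeZero q] {η : Coarse m}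
    (hη : A.prior {σ | coarseMap σ = η} ≠ 0) (k : ZMod m) :
    A.cellPrior k {τ | blockSpin τ = η k} ≠ 0 := by
  rw [prior_fiber] at hη
  exact prod_ne_zero_iff.1 hη k (mem_univ k)

/-- The probabilities of the conditional prior on a cell. -/
def cellWeight (k : ZMod m) (a : ℤ) (τ : CellConf q) : ℝ := (A.condCell k a).real {τ}

theorem cellWeight_nonneg (k : ZMod m) (a : ℤ) (τ : CellConf q) : 0 ≤ A.cellWeight k a τ :=
  measureReal_nonneg

instance (k : ZMod m) (a : ℤ) : IsFiniteMeasure (A.condCell k a) := by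
  unfold condCell
  infer_instance

theorem integral_condCell (k : ZMod m) (a : ℤ) (g : CellConf q → ℝ) :
    ∫ τ, g τ ∂(A.condCell k a) = ∑ τ, A.cellWeight k a τ * g τ :=
  integral_fintype Integrable.of_finite

theorem sum_cellWeight {k : ZMod m} {a : ℤ} (h : A.cellPrior k {τ | blockSpin τ = a} ≠ 0) :
    ∑ τ, A.cellWeight k a τ = 1 := by
  have : IsProbabilityMeasure (A.condCell k a) := cond_isProbabilityMeasure h
  have h1 := A.integral_condCell k a fun _ => 1
  simpa using h1.symm

/-- The constraint `coarseMap σ = η` is a product event over the cells, so conditioning the product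
prior on it keeps the cells independent. -/
theorem condPrior_singleton [NeZero m] [NeZero q] (η : Coarse m) (σ : Micro m q) :
    (A.condPrior η).real {σ} = ∏ k, A.cellWeight k (η k) (cellOf σ k) := by
  have := A.P_prob
  unfold condPrior cellWeight condCell
  simp_rw [measureReal_def, cond_apply (MeasurableSet.of_discrete), ENNReal.toReal_mul,
    ENNReal.toReal_inv]
  rw [prod_mul_distrib, prod_inv_distrib, prior_fiber, ENNReal.toReal_prod]
  congr 1
  rw [← ENNReal.toReal_prod, ← Measure.pi_pi, ← A.measurePreserving_cellEquiv.measure_preimage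
    (MeasurableSet.of_discrete).nullMeasurableSet]
  congr 2
  ext σ'
  simp only [Set.mem_inter_iff, Set.mem_ofPred_eq, Set.mem_singleton_iff, Set.mem_preimage,
    Set.mem_pi, Set.mem_univ, forall_true_left, cellEquiv_apply, forall_and]
  rw [← funext_iff (f := cellOf σ') (g := cellOf σ), ← cellEquiv_apply, ← cellEquiv_apply,
    (cellEquiv m q).injective.eq_iff, funext_iff]
  rfl

theorem sum_mul_pos_of_sum_eq_one {Ω : Type*} [Fintype Ω] {w f : Ω → ℝ} (hw : ∀ ω, 0 ≤ w ω)
    (hw1 : ∑ ω, w ω = 1) (hf : ∀ ω, 0 < f ω) : 0 < ∑ ω, w ω * f ω := by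
  obtain ⟨ω, -, hω⟩ := exists_ne_zero_of_sum_ne_zero (hw1.trans_ne one_ne_zero)
  exact sum_pos' (fun ω _ => mul_nonneg (hw ω) (hf ω).le)
    ⟨ω, mem_univ _, mul_pos ((hw ω).lt_of_ne' hω) (hf ω)⟩

theorem Z_eq (k : ZMod m) (a : ℤ) (b b' : Option (CellConf q)) :
    A.Z k a b b' = ∑ τ, A.cellWeight k a τ * (Real.exp (-A.β * (A.leftEnergy b τ
      + A.rightEnergy τ b')) * Real.exp (-A.β * A.cellEnergy τ)) :=
  A.integral_condCell k a _

theorem Z_pos {k : ZMod m} {a : ℤ} (h : A.cellPrior k {τ | blockSpin τ = a} ≠ 0)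
    (b b' : Option (CellConf q)) : 0 < A.Z k a b b' := by
  rw [Z_eq]
  exact sum_mul_pos_of_sum_eq_one (A.cellWeight_nonneg k a) (A.sum_cellWeight h)
    fun _ => by positivity

/-- Given the middle cell, the two outer cells integrate out independently. This identifies
Z_{k-1,k,k+1} as the normalisation of the even factor of ν. -/
theorem Z3_eq (k : ZMod m) (a₁ a₂ a₃ : ℤ) :
    A.Z3 k a₁ a₂ a₃ = ∑ τ, A.cellWeight k a₂ τ * (Real.exp (-A.β * A.cellEnergy τ)
      * A.Z (k + 1) a₃ (some τ) none * A.Z (k - 1) a₁ none (some τ)) := by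
  unfold Z3
  rw [integral_condCell]
  simp_rw [integral_condCell]
  simp_rw [mul_sum]
  rw [sum_comm]
  refine sum_congr rfl fun τ _ => ?_
  rw [Z_eq, Z_eq, mul_sum, mul_sum]
  refine sum_congr rfl fun τ₁ _ => ?_
  rw [mul_sum, sum_mul, mul_sum]
  refine sum_congr rfl fun τ₃ _ => ?_
  simp only [leftEnergy, rightEnergy, Option.elim]
  have e : Real.exp (-A.β * (A.cellEnergy τ₁ + A.bondEnergy τ₁ τ + A.cellEnergy τ
      + A.bondEnergy τ τ₃ + A.cellEnergy τ₃)) = Real.exp (-A.β * A.cellEnergy τ)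
      * (Real.exp (-A.β * (A.bondEnergy τ τ₃ + 0)) * Real.exp (-A.β * A.cellEnergy τ₃))
      * (Real.exp (-A.β * (0 + A.bondEnergy τ₁ τ)) * Real.exp (-A.β * A.cellEnergy τ₁)) := by
    simp_rw [← Real.exp_add]
    ring_nf
  rw [e]
  ring

theorem Z3_pos {k : ZMod m} {a₁ a₂ a₃ : ℤ} (h₁ : A.cellPrior (k - 1) {τ | blockSpin τ = a₁} ≠ 0)
    (h₂ : A.cellPrior k {τ | blockSpin τ = a₂} ≠ 0)
    (h₃ : A.cellPrior (k + 1) {τ | blockSpin τ = a₃} ≠ 0) : 0 < A.Z3 k a₁ a₂ a₃ := by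
  rw [Z3_eq]
  exact sum_mul_pos_of_sum_eq_one (A.cellWeight_nonneg k a₂) (A.sum_cellWeight h₂)
    fun _ => mul_pos (mul_pos (Real.exp_pos _) (A.Z_pos h₃ _ _)) (A.Z_pos h₁ _ _)

/-- The factor of the density of the reference measure that belongs to a cell. -/
def nuFactor (η : Coarse m) (k : ZMod m) (ω : ZMod m → CellConf q) (τ : CellConf q) : ℝ :=
  if Odd k.val then
    Real.exp (-A.β * (A.cellEnergy τ + A.bondEnergy (ω (k - 1)) τ + A.bondEnergy τ (ω (k + 1))))
      / A.Z k (η k) (some (ω (k - 1))) (some (ω (k + 1)))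
  else
    Real.exp (-A.β * A.cellEnergy τ) * A.Z (k + 1) (η (k + 1)) (some τ) none
      * A.Z (k - 1) (η (k - 1)) none (some τ) / A.Z3 k (η (k - 1)) (η k) (η (k + 1))

/-- The transition probabilities of the reference measure. -/
def nuKernel (η : Coarse m) (k : ZMod m) (ω : ZMod m → CellConf q) (τ : CellConf q) : ℝ :=
  A.cellWeight k (η k) τ * A.nuFactor η k ω τ

theorem nuDensity_eq [NeZero m] (η : Coarse m) (σ : Micro m q) :
    A.nuDensity η σ = ∏ k, A.nuFactor η k (cellOf σ) (cellOf σ k) := by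
  rw [← prod_odd_mul_prod_even]
  unfold nuDensity
  congr 1
  · refine prod_congr rfl fun k hk => ?_
    rw [nuFactor, if_pos (mem_filter.1 hk).2]
  · refine prod_congr rfl fun k hk => ?_
    rw [nuFactor, if_neg (Nat.not_odd_iff_even.2 (mem_filter.1 hk).2)]

section

variable [NeZero m] [NeZero q] {η : Coarse m}

theorem nuFactor_pos (hη : A.prior {σ | coarseMap σ = η} ≠ 0) (k : ZMod m)
    (ω : ZMod m → CellConf q) (τ : CellConf q) : 0 < A.nuFactor η k ω τ := by
  have h := A.cellPrior_ne_zero hη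
  unfold nuFactor
  split_ifs
  · exact div_pos (Real.exp_pos _) (A.Z_pos (h k) _ _)
  · exact div_pos (mul_pos (mul_pos (Real.exp_pos _) (A.Z_pos (h _) _ _)) (A.Z_pos (h _) _ _))
      (A.Z3_pos (h _) (h _) (h _))

theorem sum_nuKernel (hη : A.prior {σ | coarseMap σ = η} ≠ 0) (k : ZMod m)
    (ω : ZMod m → CellConf q) : ∑ τ, A.nuKernel η k ω τ = 1 := by
  have h := A.cellPrior_ne_zero hη
  unfold nuKernel nuFactor
  split_ifs
  · simp_rw [← mul_div_assoc]
    rw [← sum_div, div_eq_one_iff_eq (A.Z_pos (h k) _ _).ne', Z_eq]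
    refine sum_congr rfl fun τ _ => ?_
    rw [← Real.exp_add]
    simp only [leftEnergy, rightEnergy, Option.elim]
    congr 2
    ring
  · simp_rw [← mul_div_assoc]
    rw [← sum_div, div_eq_one_iff_eq (A.Z3_pos (h _) (h k) (h _)).ne', Z3_eq]

/-- The cells whose transition probabilities depend on the configuration of the cell `j`. -/
def nuAdj (j : ZMod m) : Finset (ZMod m) := if Odd j.val then ∅ else {j - 1, j + 1}

/-- The even kernels depend on no other cell, the odd ones only on their two even neighbours. -/
theorem isTwoLayer_nuKernel (hm : Even m) (hη : A.prior {σ | coarseMap σ = η} ≠ 0) :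
    IsTwoLayer (A.nuKernel η) (nuAdj (m := m)) where
  nonneg k ω τ := mul_nonneg (A.cellWeight_nonneg _ _ _) (A.nuFactor_pos hη k ω τ).le
  sum_eq_one := A.sum_nuKernel hη
  indep j k hk ω τ := by
    funext τ'
    unfold nuKernel nuFactor
    split_ifs with hodd
    · have h1 : k - 1 ≠ j := by
        rintro rfl
        have := (odd_val_sub_one hm k).not.2 (not_not.2 hodd)
        rw [nuAdj, if_neg this] at hk
        simp at hk
      have h2 : k + 1 ≠ j := by
        rintro rfl
        have := (odd_val_add_one hm k).not.2 (not_not.2 hodd)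
        rw [nuAdj, if_neg this] at hk
        simp at hk
      rw [Function.update_of_ne h1, Function.update_of_ne h2]
    · rfl
  adj_adj j k hk := by
    unfold nuAdj at hk ⊢
    split_ifs at hk with h
    · simp at hk
    · rw [if_pos]
      rcases mem_insert.1 hk with rfl | hk
      · exact (odd_val_sub_one hm j).2 h
      · rw [mem_singleton.1 hk]
        exact (odd_val_add_one hm j).2 h
  card_le j := by
    unfold nuAdj
    split_ifs
    · simp
    · exact card_le_two

instance (η : Coarse m) : IsFiniteMeasure (A.condPrior η) := by
  unfold condPrior
  infer_instance

theorem integral_nuDensity_mul (η : Coarse m) (g : Micro m q → ℝ) :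
    ∫ σ, A.nuDensity η σ * g σ ∂(A.condPrior η)
      = ∑ ω, (∏ k, A.nuKernel η k ω (ω k)) * g ((cellEquiv m q).symm ω) := by
  rw [integral_fintype Integrable.of_finite, ← (cellEquiv m q).symm.sum_comp]
  refine sum_congr rfl fun ω _ => ?_
  rw [condPrior_singleton, nuDensity_eq, cellOf_symm, smul_eq_mul, ← mul_assoc]
  congr 1
  rw [← prod_mul_distrib]
  rfl

theorem integral_nu (hη : A.prior {σ | coarseMap σ = η} ≠ 0) (g : Micro m q → ℝ) :
    ∫ σ, g σ ∂(A.nu η)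
      = ∑ ω, (∏ k, A.nuKernel η k ω (ω k)) * g ((cellEquiv m q).symm ω) := by
  rw [← integral_nuDensity_mul]
  unfold nu
  rw [integral_withDensity_eq_integral_toReal_smul (measurable_of_finite _)
    (Filter.Eventually.of_forall fun _ => ENNReal.ofReal_lt_top)]
  refine integral_congr_ae (Filter.Eventually.of_forall fun σ => ?_)
  have : 0 ≤ A.nuDensity η σ := by
    rw [nuDensity_eq]
    exact prod_nonneg fun k _ => (A.nuFactor_pos hη k _ _).le
  simp only [ENNReal.toReal_ofReal this, smul_eq_mul]

end

end Model

end ReferenceMeasure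

/-! ### The expansion around the reference measure -/

section Expansion

open Finset

/-- The smallness of f^s and f^l enters only here: |e^x - 1| ≤ 1/2 forces |x| ≤ 1, where the
quadratic Taylor bound holds. -/
theorem abs_exp_sub_one_sub_le_sq {x : ℝ} (h : |Real.exp x - 1| ≤ 1 / 2) :
    |Real.exp x - 1 - x| ≤ x ^ 2 := by
  obtain ⟨h1, h2⟩ := abs_le.1 h
  refine Real.abs_exp_sub_one_sub_id_le (abs_le.2 ⟨?_, ?_⟩)
  · have h3 := Real.add_one_le_exp (-x)
    have h4 : Real.exp (-x) ≤ 2 := by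
      rw [Real.exp_neg]
      exact inv_le_of_inv_le₀ (by norm_num) (by linarith)
    linarith
  · linarith [Real.add_one_le_exp x]

theorem abs_sum_mul_sub_le {Ω : Type*} [Fintype Ω] {w : Ω → ℝ} (hw : ∀ ω, 0 ≤ w ω)
    (hw1 : ∑ ω, w ω = 1) {f g : Ω → ℝ} {c : ℝ} (h : ∀ ω, |f ω - g ω| ≤ c) :
    |∑ ω, w ω * f ω - ∑ ω, w ω * g ω| ≤ c := by
  rw [← sum_sub_distrib]
  refine (abs_sum_le_sum_abs _ _).trans ?_
  calc _ ≤ ∑ ω, w ω * c := by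
        refine sum_le_sum fun ω _ => ?_
        rw [← mul_sub, abs_mul, abs_of_nonneg (hw ω)]
        exact mul_le_mul_of_nonneg_left (h ω) (hw ω)
    _ = c := by rw [← sum_mul, hw1, one_mul]

namespace Model

variable {m q : ℕ} (A : Model m q)

/-- The logarithm of `1 + f^s_{k-1,k+1}`. -/
def shortLog (η : Coarse m) (k : ZMod m) (ω : ZMod m → CellConf q) : ℝ :=
  Real.log (1 + A.fShort k (η k) (ω (k - 1)) (ω (k + 1)))

theorem one_add_fShort_pos {k : ZMod m} {a : ℤ} (h : A.cellPrior k {τ | blockSpin τ = a} ≠ 0)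
    (τ τ' : CellConf q) : 0 < 1 + A.fShort k a τ τ' := by
  unfold fShort
  have := A.Z_pos h
  rw [add_sub_cancel]
  exact div_pos (mul_pos (this _ _) (this _ _)) (mul_pos (this _ _) (this _ _))

theorem Z_le_exp_mul (k : ZMod m) (a : ℤ) {b b' c c' : Option (CellConf q)} {d : ℝ}
    (h : ∀ τ, -A.β * (A.leftEnergy b τ + A.rightEnergy τ b')
      ≤ d + -A.β * (A.leftEnergy c τ + A.rightEnergy τ c')) :
    A.Z k a b b' ≤ Real.exp d * A.Z k a c c' := by
  rw [Z_eq, Z_eq, mul_sum]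
  refine sum_le_sum fun τ _ => ?_
  have h1 := Real.exp_le_exp.2 (h τ)
  rw [Real.exp_add] at h1
  rw [mul_left_comm (Real.exp d), ← mul_assoc (Real.exp d)]
  exact mul_le_mul_of_nonneg_left (mul_le_mul_of_nonneg_right h1 (Real.exp_pos _).le)
    (A.cellWeight_nonneg _ _ _)

/-- The short-range part of `q δ`. -/
def shortSize : ℝ := A.β * (A.S * A.U.size A.S)

theorem abs_beta_bondEnergy_le (τ τ' : CellConf q) :
    |A.β * A.bondEnergy τ τ'| ≤ A.shortSize := by
  rw [abs_mul, abs_of_pos A.β_pos]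
  exact mul_le_mul_of_nonneg_left (A.abs_bondEnergy_le τ τ') A.β_pos.le

theorem shortSize_nonneg : 0 ≤ A.shortSize :=
  mul_nonneg A.β_pos.le (mul_nonneg (Nat.cast_nonneg _) (size_nonneg _ _))

/-- 1 + f^s is the ratio Z(τ,τ')/Z(0,τ') times the ratio Z(0,0)/Z(τ,0). In each of them only the
left boundary condition changes, which costs at most a factor e^{±βS‖U‖}. -/
theorem abs_log_one_add_fShort_le {k : ZMod m} {a : ℤ}
    (h : A.cellPrior k {τ | blockSpin τ = a} ≠ 0) (τ τ' : CellConf q) :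
    |Real.log (1 + A.fShort k a τ τ')| ≤ 2 * A.shortSize := by
  have hZ := A.Z_pos h
  have hB : ∀ u v, -A.shortSize ≤ A.β * A.bondEnergy u v ∧ A.β * A.bondEnergy u v ≤ A.shortSize :=
    fun u v => abs_le.1 (A.abs_beta_bondEnergy_le u v)
  have h1 : A.Z k a (some τ) (some τ') ≤ Real.exp A.shortSize * A.Z k a none (some τ') := by
    refine A.Z_le_exp_mul k a fun u => ?_
    simp only [leftEnergy, rightEnergy, Option.elim]
    linarith [hB τ u]
  have h2 : A.Z k a none (some τ') ≤ Real.exp A.shortSize * A.Z k a (some τ) (some τ') := by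
    refine A.Z_le_exp_mul k a fun u => ?_
    simp only [leftEnergy, rightEnergy, Option.elim]
    linarith [hB τ u]
  have h3 : A.Z k a (some τ) none ≤ Real.exp A.shortSize * A.Z k a none none := by
    refine A.Z_le_exp_mul k a fun u => ?_
    simp only [leftEnergy, rightEnergy, Option.elim]
    linarith [hB τ u]
  have h4 : A.Z k a none none ≤ Real.exp A.shortSize * A.Z k a (some τ) none := by
    refine A.Z_le_exp_mul k a fun u => ?_
    simp only [leftEnergy, rightEnergy, Option.elim]
    linarith [hB τ u]
  have l1 := Real.log_le_log (hZ _ _) h1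
  have l2 := Real.log_le_log (hZ _ _) h2
  have l3 := Real.log_le_log (hZ _ _) h3
  have l4 := Real.log_le_log (hZ _ _) h4
  rw [Real.log_mul (Real.exp_pos _).ne' (hZ _ _).ne', Real.log_exp] at l1 l2 l3 l4
  unfold fShort
  rw [add_sub_cancel, Real.log_div (mul_pos (hZ _ _) (hZ _ _)).ne'
    (mul_pos (hZ _ _) (hZ _ _)).ne', Real.log_mul (hZ _ _).ne' (hZ _ _).ne',
    Real.log_mul (hZ _ _).ne' (hZ _ _).ne', abs_le]
  constructor <;> linarith

section

variable [NeZero m] [NeZero q]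

/-- The logarithm of `1 + f^l_{kl}`, as a function of the configurations of the cells. -/
def longLog (p : ZMod m × ZMod m) (ω : ZMod m → CellConf q) : ℝ :=
  -A.β * A.longError p.1 p.2 ((cellEquiv m q).symm ω)

/-- The logarithm of `∏_{k odd} (1 + f^s_{k-1,k+1}) ∏_{k ≤ l} (1 + f^l_{kl})`. -/
def totalLog (η : Coarse m) (ω : ZMod m → CellConf q) : ℝ :=
  ∑ k : ZMod m with Odd k.val, A.shortLog η k ω
    + ∑ p : ZMod m × ZMod m with p.1.val ≤ p.2.val, A.longLog p ω

/-- Every bond joins an odd and an even cell and is assigned to its odd end, as in the definition of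
ν. -/
theorem exp_shortHamiltonian (hm : Even m) (σ : Micro m q) :
    Real.exp (-A.β * A.shortHamiltonian σ) =
      (∏ k : ZMod m with Odd k.val, Real.exp (-A.β * (A.cellEnergy (cellOf σ k)
        + A.bondEnergy (cellOf σ (k - 1)) (cellOf σ k)
        + A.bondEnergy (cellOf σ k) (cellOf σ (k + 1))))) *
      ∏ k : ZMod m with Even k.val, Real.exp (-A.β * A.cellEnergy (cellOf σ k)) := by
  rw [shortHamiltonian_eq, mul_sum, Real.exp_sum, ← prod_odd_mul_prod_even]
  have h : ∀ k, Real.exp (-A.β * (A.cellEnergy (cellOf σ k)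
      + A.bondEnergy (cellOf σ k) (cellOf σ (k + 1))))
      = Real.exp (-A.β * A.cellEnergy (cellOf σ k))
        * Real.exp (-A.β * A.bondEnergy (cellOf σ k) (cellOf σ (k + 1))) := by
    intro k
    rw [← Real.exp_add]
    ring_nf
  simp_rw [h]
  rw [prod_mul_distrib (s := univ.filter fun k : ZMod m => Even k.val),
    prod_even_eq hm fun k => Real.exp (-A.β * A.bondEnergy (cellOf σ k) (cellOf σ (k + 1))),
    mul_comm (∏ k : ZMod m with Even k.val, _), ← mul_assoc, ← prod_mul_distrib]
  congr 1
  refine prod_congr rfl fun k _ => ?_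
  simp_rw [← Real.exp_add, sub_add_cancel]
  ring_nf

variable {η : Coarse m}

theorem exp_shortCoarse (hη : A.prior {σ | coarseMap σ = η} ≠ 0) :
    Real.exp (-A.β * A.shortCoarse η) = (∏ k : ZMod m with Odd k.val, A.Z k (η k) none none)⁻¹ *
      ∏ k : ZMod m with Even k.val, A.Z3 k (η (k - 1)) (η k) (η (k + 1)) := by
  have h := A.cellPrior_ne_zero hη
  have hβ := A.β_pos.ne'
  have e : -A.β * A.shortCoarse η = -∑ k : ZMod m with Odd k.val, Real.log (A.Z k (η k) none none)
      + ∑ k : ZMod m with Even k.val, Real.log (A.Z3 k (η (k - 1)) (η k) (η (k + 1))) := by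
    unfold shortCoarse
    field_simp
    ring
  rw [e, Real.exp_add, Real.exp_neg, Real.exp_sum, Real.exp_sum]
  congr 1
  · congr 1
    exact prod_congr rfl fun k _ => Real.exp_log (A.Z_pos (h k) _ _)
  · exact prod_congr rfl fun k _ => Real.exp_log (A.Z3_pos (h _) (h _) (h _))

theorem exp_sum_shortLog (hη : A.prior {σ | coarseMap σ = η} ≠ 0) (ω : ZMod m → CellConf q) :
    Real.exp (∑ k : ZMod m with Odd k.val, A.shortLog η k ω) =
      (∏ k : ZMod m with Odd k.val, A.Z k (η k) (some (ω (k - 1))) (some (ω (k + 1)))) *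
      (∏ k : ZMod m with Odd k.val, A.Z k (η k) none none) /
      ((∏ k : ZMod m with Odd k.val, A.Z k (η k) none (some (ω (k + 1)))) *
      ∏ k : ZMod m with Odd k.val, A.Z k (η k) (some (ω (k - 1))) none) := by
  have h := A.cellPrior_ne_zero hη
  rw [Real.exp_sum, ← prod_mul_distrib, ← prod_mul_distrib, ← prod_div_distrib]
  refine prod_congr rfl fun k _ => ?_
  rw [shortLog, Real.exp_log (A.one_add_fShort_pos (h k) _ _), fShort, add_sub_cancel]

/-- The Boltzmann weight in terms of the first approximation and of the reference measure. -/
theorem exp_hamiltonian (hm : Even m) (hη : A.prior {σ | coarseMap σ = η} ≠ 0) {σ : Micro m q}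
    (hσ : coarseMap σ = η) :
    Real.exp (-A.β * A.hamiltonian σ) = Real.exp (-A.β * A.coarse0 η)
      * (A.nuDensity η σ * Real.exp (A.totalLog η (cellOf σ))) := by
  have h := A.cellPrior_ne_zero hη
  have hlong : ∑ p : ZMod m × ZMod m with p.1.val ≤ p.2.val, A.longLog p (cellOf σ)
      = -A.β * (A.longHamiltonian σ - A.longCoarse η) := by
    rw [longHamiltonian_eq, hσ, add_sub_cancel_left, mul_sum]
    simp only [longLog, ← cellEquiv_apply, Equiv.symm_apply_apply]
  have hs : Real.exp (-A.β * A.shortHamiltonian σ) = Real.exp (-A.β * A.shortCoarse η)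
      * (A.nuDensity η σ * Real.exp (∑ k : ZMod m with Odd k.val, A.shortLog η k (cellOf σ))) := by
    rw [A.exp_shortHamiltonian hm, A.exp_shortCoarse hη, A.exp_sum_shortLog hη]
    unfold nuDensity
    simp_rw [prod_div_distrib, prod_mul_distrib]
    -- Reindexed by their odd cell, the one-sided partition functions in the even factors of ν
    -- cancel the denominators of 1 + f^s. The two-sided ones cancel the odd normalisations, and the
    -- rest cancels `shortCoarse`.
    rw [prod_even_eq' hm fun k => A.Z (k - 1) (η (k - 1)) none (some (cellOf σ k)),
      prod_even_eq hm fun k => A.Z (k + 1) (η (k + 1)) (some (cellOf σ k)) none]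
    simp only [sub_add_cancel, add_sub_cancel_right]
    have n1 : ∏ k : ZMod m with Odd k.val, A.Z k (η k) none none ≠ 0 :=
      prod_ne_zero_iff.2 fun k _ => (A.Z_pos (h k) _ _).ne'
    have n2 : ∏ k : ZMod m with Odd k.val, A.Z k (η k) none (some (cellOf σ (k + 1))) ≠ 0 :=
      prod_ne_zero_iff.2 fun k _ => (A.Z_pos (h k) _ _).ne'
    have n3 : ∏ k : ZMod m with Odd k.val, A.Z k (η k) (some (cellOf σ (k - 1))) none ≠ 0 :=
      prod_ne_zero_iff.2 fun k _ => (A.Z_pos (h k) _ _).ne'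
    have n4 : ∏ k : ZMod m with Odd k.val,
        A.Z k (η k) (some (cellOf σ (k - 1))) (some (cellOf σ (k + 1))) ≠ 0 :=
      prod_ne_zero_iff.2 fun k _ => (A.Z_pos (h k) _ _).ne'
    have n5 : ∏ k : ZMod m with Even k.val, A.Z3 k (η (k - 1)) (η k) (η (k + 1)) ≠ 0 :=
      prod_ne_zero_iff.2 fun k _ => (A.Z3_pos (h _) (h _) (h _)).ne'
    field_simp
  unfold hamiltonian coarse0 totalLog
  rw [hlong, mul_add, Real.exp_add, hs, mul_add, Real.exp_add, Real.exp_add, mul_sub, Real.exp_sub]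
  field_simp

/-- The conditional partition function of the error of the first approximation. -/
def correction (η : Coarse m) : ℝ :=
  ∑ ω, (∏ k, A.nuKernel η k ω (ω k)) * Real.exp (A.totalLog η ω)

theorem integral_exp_hamiltonian (hm : Even m) (hη : A.prior {σ | coarseMap σ = η} ≠ 0) :
    ∫ σ, Real.exp (-A.β * A.hamiltonian σ) ∂(A.condPrior η)
      = Real.exp (-A.β * A.coarse0 η) * A.correction η := by
  have hae : ∀ᵐ σ ∂(A.condPrior η), coarseMap σ = η :=
    ae_cond_mem (s := {σ : Micro m q | coarseMap σ = η}) MeasurableSet.of_discrete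
  rw [integral_congr_ae (hae.mono fun σ hσ => A.exp_hamiltonian hm hη hσ), integral_const_mul,
    integral_nuDensity_mul]
  simp only [cellOf_symm]
  rfl

/-- The long-range part of `q δ`. -/
def longSize : ℝ := A.β * q ^ 2 * A.gradNorm / A.L

omit [NeZero m] [NeZero q] in
theorem longSize_nonneg : 0 ≤ A.longSize := by
  have := A.β_pos
  have := A.gradNorm_nonneg
  have := A.L_pos
  unfold longSize
  positivity

omit [NeZero m] in
theorem mul_delta_eq : q * A.delta = A.shortSize + A.longSize := by
  have hq : (q : ℝ) ≠ 0 := Nat.cast_ne_zero.2 (NeZero.ne q)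
  unfold delta shortSize longSize
  field_simp

theorem abs_shortLog_le (hη : A.prior {σ | coarseMap σ = η} ≠ 0) (k : ZMod m)
    (ω : ZMod m → CellConf q) : |A.shortLog η k ω| ≤ 2 * A.shortSize :=
  A.abs_log_one_add_fShort_le (A.cellPrior_ne_zero hη k) _ _

theorem abs_longLog_le (p : ZMod m × ZMod m) (ω : ZMod m → CellConf q) :
    |A.longLog p ω| ≤ A.longBound p.1 p.2 :=
  A.abs_longError_le _ _ _

theorem abs_sum_sub_sum_le {β : Type*} (s : Finset β) (P : β → Prop) [DecidablePred P]
    {u v b : β → ℝ} (hu : ∀ a, |u a| ≤ b a) (hv : ∀ a, |v a| ≤ b a)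
    (huv : ∀ a, ¬ P a → u a = v a) :
    |∑ a ∈ s, u a - ∑ a ∈ s, v a| ≤ ∑ a ∈ s with P a, 2 * b a := by
  rw [← sum_sub_distrib, sum_filter]
  refine (abs_sum_le_sum_abs _ _).trans (sum_le_sum fun a _ => ?_)
  split_ifs with h
  · exact (abs_sub _ _).trans (by linarith [hu a, hv a])
  · rw [huv a h, sub_self, abs_zero]

/-- The oscillation of the logarithm of the density in one cell. -/
theorem abs_totalLog_update_sub_le (hη : A.prior {σ | coarseMap σ = η} ≠ 0) (j : ZMod m)
    (ω : ZMod m → CellConf q) (τ τ' : CellConf q) :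
    |A.totalLog η (Function.update ω j τ) - A.totalLog η (Function.update ω j τ')|
      ≤ 40 * (q * A.delta) := by
  set u := Function.update ω j τ with hu
  set v := Function.update ω j τ' with hv
  have huv : ∀ k, k ≠ j → u k = v k := fun k hk => by
    rw [hu, hv, Function.update_of_ne hk, Function.update_of_ne hk]
  have hS : |∑ k : ZMod m with Odd k.val, A.shortLog η k u
      - ∑ k : ZMod m with Odd k.val, A.shortLog η k v| ≤ 8 * A.shortSize := by
    refine (abs_sum_sub_sum_le _ (fun k => k - 1 = j ∨ k + 1 = j)
      (fun k => A.abs_shortLog_le hη k u) (fun k => A.abs_shortLog_le hη k v) ?_).trans ?_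
    · intro k hk
      rw [not_or] at hk
      rw [shortLog, shortLog, huv _ hk.1, huv _ hk.2]
    · rw [sum_const, nsmul_eq_mul]
      -- Only the short-range factors of the two odd neighbours see the cell j; each changes by at
      -- most 2 · 2 `shortSize`, in total 8 `shortSize`.
      have hsub : {k ∈ univ.filter fun k : ZMod m => Odd k.val | k - 1 = j ∨ k + 1 = j}
          ⊆ {j + 1, j - 1} := by
        intro k hk
        rcases (mem_filter.1 hk).2 with rfl | rfl <;> simp
      have hc : (({k ∈ univ.filter fun k : ZMod m => Odd k.val | k - 1 = j ∨ k + 1 = j}.card : ℕ)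
          : ℝ) ≤ 2 := by
        exact_mod_cast (card_le_card hsub).trans card_le_two
      have := A.shortSize_nonneg
      nlinarith
  have hL : |∑ p : ZMod m × ZMod m with p.1.val ≤ p.2.val, A.longLog p u
      - ∑ p : ZMod m × ZMod m with p.1.val ≤ p.2.val, A.longLog p v| ≤ 40 * A.longSize := by
    refine (abs_sum_sub_sum_le _ (fun p => p.1 = j ∨ p.2 = j)
      (fun p => A.abs_longLog_le p u) (fun p => A.abs_longLog_le p v) ?_).trans ?_
    · intro p hp
      rw [not_or] at hp
      unfold longLog
      rw [A.longError_congr]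
      · rw [cellOf_symm, cellOf_symm, huv _ hp.1]
      · rw [cellOf_symm, cellOf_symm, huv _ hp.2]
    · have h0 := A.longBound_nonneg
      -- j may be either entry of the pair and each logarithm changes by at most twice its bound,
      -- hence 4 row sums of at most 10 `longSize` each.
      calc _ ≤ ∑ p : ZMod m × ZMod m, ((if p.1 = j then 2 * A.longBound p.1 p.2 else 0)
              + if p.2 = j then 2 * A.longBound p.1 p.2 else 0) := by
            rw [sum_filter, sum_filter]
            refine sum_le_sum fun p _ => ?_
            have := h0 p.1 p.2
            split_ifs <;> first | linarith | tauto
        _ = 4 * ∑ l, A.longBound j l := by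
            rw [sum_add_distrib, Fintype.sum_prod_type, Fintype.sum_prod_type_right]
            have e1 : ∀ x y : ZMod m, (if x = j then 2 * A.longBound x y else 0)
                = if x = j then 2 * A.longBound j y else 0 := by
              intro x y
              split_ifs with h
              · rw [h]
              · rfl
            have e2 : ∀ x y : ZMod m, (if y = j then 2 * A.longBound x y else 0)
                = if y = j then 2 * A.longBound j x else 0 := by
              intro x y
              split_ifs with h
              · rw [h, A.longBound_comm]
              · rfl
            simp only [e1, e2]
            rw [sum_comm]
            simp only [sum_ite_eq', mem_univ, if_true]
            rw [← mul_sum]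
            ring
        _ ≤ _ := by
            have := A.sum_longBound_le j
            unfold longSize
            linarith
  rw [mul_delta_eq]
  unfold totalLog
  have := A.shortSize_nonneg
  rw [abs_le] at hS hL ⊢
  constructor <;> linarith [hS.1, hS.2, hL.1, hL.2]

/-- The first correction agrees with the integral of the logarithm of the density to first
order. -/
theorem abs_coarse1_sub_le (hm : Even m) (hη : A.prior {σ | coarseMap σ = η} ≠ 0)
    (hs : ∀ k : ZMod m, Odd k.val → ∀ τ τ' : CellConf q, |A.fShort k (η k) τ τ'| ≤ 1 / 2)
    (hl : ∀ (k l : ZMod m) (σ : Micro m q), |A.fLong k l σ| ≤ 1 / 2) :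
    |-A.β * A.coarse1 η - ∑ ω, (∏ k, A.nuKernel η k ω (ω k)) * A.totalLog η ω|
      ≤ m * (100 * (q * A.delta) ^ 2) := by
  have hp := A.isTwoLayer_nuKernel hm hη
  have hw : ∀ ω, 0 ≤ ∏ k, A.nuKernel η k ω (ω k) := fun ω => prod_nonneg fun _ _ => hp.nonneg _ _ _
  have hw1 := hp.sum_prod_eq_one
  have e1 : -A.β * A.coarse1 η = ∑ k : ZMod m with Odd k.val,
        ∑ ω, (∏ k, A.nuKernel η k ω (ω k)) * (Real.exp (A.shortLog η k ω) - 1)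
      + ∑ p : ZMod m × ZMod m with p.1.val ≤ p.2.val,
        ∑ ω, (∏ k, A.nuKernel η k ω (ω k)) * (Real.exp (A.longLog p ω) - 1) := by
    unfold coarse1
    rw [← mul_assoc, show -A.β * -(1 / A.β) = 1 by have := A.β_pos.ne'; field_simp, one_mul]
    congr 1
    · refine sum_congr rfl fun k _ => ?_
      rw [A.integral_nu hη]
      refine sum_congr rfl fun ω _ => ?_
      rw [cellOf_symm, shortLog,
        Real.exp_log (A.one_add_fShort_pos (A.cellPrior_ne_zero hη k) _ _), add_sub_cancel_left]
    · refine sum_congr rfl fun p _ => ?_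
      rw [A.integral_nu hη]
      rfl
  have e2 : ∑ ω, (∏ k, A.nuKernel η k ω (ω k)) * A.totalLog η ω = ∑ k : ZMod m with Odd k.val,
        ∑ ω, (∏ k, A.nuKernel η k ω (ω k)) * A.shortLog η k ω
      + ∑ p : ZMod m × ZMod m with p.1.val ≤ p.2.val,
        ∑ ω, (∏ k, A.nuKernel η k ω (ω k)) * A.longLog p ω := by
    unfold totalLog
    simp_rw [mul_add, sum_add_distrib, mul_sum]
    rw [sum_comm, sum_comm (s := univ) (t := univ.filter fun p : ZMod m × ZMod m => _)]
  rw [e1, e2, add_sub_add_comm, ← sum_sub_distrib, ← sum_sub_distrib]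
  refine (abs_add_le _ _).trans ?_
  have hS : |∑ k : ZMod m with Odd k.val,
      (∑ ω, (∏ k, A.nuKernel η k ω (ω k)) * (Real.exp (A.shortLog η k ω) - 1)
        - ∑ ω, (∏ k, A.nuKernel η k ω (ω k)) * A.shortLog η k ω)|
      ≤ m * (2 * A.shortSize) ^ 2 := by
    refine (abs_sum_le_sum_abs _ _).trans ?_
    have h1 : ∀ k ∈ univ.filter fun k : ZMod m => Odd k.val,
        |∑ ω, (∏ k, A.nuKernel η k ω (ω k)) * (Real.exp (A.shortLog η k ω) - 1)
        - ∑ ω, (∏ k, A.nuKernel η k ω (ω k)) * A.shortLog η k ω| ≤ (2 * A.shortSize) ^ 2 := by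
      intro k hk
      refine abs_sum_mul_sub_le hw hw1 fun ω => ?_
      refine (abs_exp_sub_one_sub_le_sq ?_).trans (sq_le_sq' ?_ ?_)
      · rw [shortLog, Real.exp_log (A.one_add_fShort_pos (A.cellPrior_ne_zero hη k) _ _),
          add_sub_cancel_left]
        exact hs k (mem_filter.1 hk).2 _ _
      · exact (abs_le.1 (A.abs_shortLog_le hη k ω)).1
      · exact (abs_le.1 (A.abs_shortLog_le hη k ω)).2
    refine (sum_le_card_nsmul _ _ _ h1).trans ?_
    rw [nsmul_eq_mul]
    refine mul_le_mul_of_nonneg_right ?_ (sq_nonneg _)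
    have := card_filter_le (univ : Finset (ZMod m)) fun k => Odd k.val
    rw [card_univ, ZMod.card] at this
    exact_mod_cast this
  have hL : |∑ p : ZMod m × ZMod m with p.1.val ≤ p.2.val,
      (∑ ω, (∏ k, A.nuKernel η k ω (ω k)) * (Real.exp (A.longLog p ω) - 1)
        - ∑ ω, (∏ k, A.nuKernel η k ω (ω k)) * A.longLog p ω)|
      ≤ m * (10 * A.longSize) ^ 2 := by
    refine (abs_sum_le_sum_abs _ _).trans ?_
    -- The squares are summed row by row with ∑ b² ≤ (∑ b)², which keeps the bound linear in m, with
    -- a constant independent of the number L/q of neighbours.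
    calc _ ≤ ∑ p : ZMod m × ZMod m, A.longBound p.1 p.2 ^ 2 := by
          refine (sum_le_sum fun p _ => ?_).trans
            (sum_le_sum_of_subset_of_nonneg (filter_subset _ _) fun _ _ _ => sq_nonneg _)
          refine abs_sum_mul_sub_le hw hw1 fun ω => ?_
          refine (abs_exp_sub_one_sub_le_sq (hl p.1 p.2 _)).trans (sq_le_sq' ?_ ?_)
          · exact (abs_le.1 (A.abs_longLog_le p ω)).1
          · exact (abs_le.1 (A.abs_longLog_le p ω)).2
      _ ≤ ∑ _k : ZMod m, (10 * A.longSize) ^ 2 := by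
          rw [Fintype.sum_prod_type]
          refine sum_le_sum fun k _ => ?_
          have h0 := A.longBound_nonneg k
          refine (sum_sq_le_sq_sum_of_nonneg fun l _ => h0 l).trans ?_
          exact pow_le_pow_left₀ (sum_nonneg fun l _ => h0 l) (A.sum_longBound_le k) 2
      _ = _ := by
          rw [sum_const, card_univ, ZMod.card, nsmul_eq_mul]
  refine (add_le_add hS hL).trans ?_
  rw [← mul_add, mul_delta_eq]
  refine mul_le_mul_of_nonneg_left ?_ (Nat.cast_nonneg m)
  have h1 := A.shortSize_nonneg
  have h2 := A.longSize_nonneg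
  nlinarith [mul_nonneg h1 h2, sq_nonneg A.shortSize]

theorem correction_pos (hm : Even m) (hη : A.prior {σ | coarseMap σ = η} ≠ 0) :
    0 < A.correction η := by
  have hp := A.isTwoLayer_nuKernel hm hη
  exact sum_mul_pos_of_sum_eq_one (fun ω => prod_nonneg fun _ _ => hp.nonneg _ _ _)
    hp.sum_prod_eq_one fun _ => Real.exp_pos _

/-- The first correction is the logarithm of the conditional partition function up to an error of
second order. -/
theorem abs_log_correction_sub_le (hm : Even m) (hη : A.prior {σ | coarseMap σ = η} ≠ 0)
    (hs : ∀ k : ZMod m, Odd k.val → ∀ τ τ' : CellConf q, |A.fShort k (η k) τ τ'| ≤ 1 / 2)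
    (hl : ∀ (k l : ZMod m) (σ : Micro m q), |A.fLong k l σ| ≤ 1 / 2) :
    |Real.log (A.correction η) - -A.β * A.coarse1 η| ≤ m * (14500 * (q * A.delta) ^ 2) := by
  have hp := A.isTwoLayer_nuKernel hm hη
  have hw : ∀ ω, 0 ≤ ∏ k, A.nuKernel η k ω (ω k) := fun ω => prod_nonneg fun _ _ => hp.nonneg _ _ _
  have hG := A.correction_pos hm hη
  have hδ : 0 ≤ q * A.delta := by
    rw [mul_delta_eq]
    exact add_nonneg A.shortSize_nonneg A.longSize_nonneg
  -- Jensen gives the lower bound and the bounded difference inequality the upper one. The constant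
  -- is 14500 = 9 · 40² + 100, the last term being the error of `abs_coarse1_sub_le`.
  have h1 := (Real.le_log_iff_exp_le hG).2 (exp_sum_mul_le hw hp.sum_prod_eq_one (A.totalLog η))
  have h2 := (Real.log_le_iff_le_exp hG).2 (hp.sum_exp_le
    (mul_nonneg (by norm_num : (0 : ℝ) ≤ 40) hδ) (A.abs_totalLog_update_sub_le hη))
  rw [ZMod.card] at h2
  obtain ⟨h3, h4⟩ := abs_le.1 (A.abs_coarse1_sub_le hm hη hs hl)
  have h5 : 0 ≤ (m : ℝ) * (q * A.delta) ^ 2 := by positivity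
  rw [abs_le]
  constructor <;> nlinarith

end

end Model

end Expansion

/-! ### The relative entropy -/

section Entropy

open Finset

/-- The image of a tilted measure is tilted by the logarithm of the conditional partition
functions. -/
theorem map_tilted_eq {α β : Type*} [Fintype α] [MeasurableSpace α] [DiscreteMeasurableSpace α]
    [Countable β] [MeasurableSpace β] [DiscreteMeasurableSpace β] (μ : Measure α)
    [IsProbabilityMeasure μ] (F : α → β) (h : α → ℝ) (w : β → ℝ)
    (hw : ∀ b, μ {a | F a = b} ≠ 0 →
      ∫ a, Real.exp (h a) ∂(ProbabilityTheory.cond μ {a | F a = b}) = Real.exp (w b)) :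
    (μ.tilted h).map F = (μ.map F).tilted w := by
  classical
  -- On each fibre of F the weights e^h and e^{w ∘ F} have the same integral: for a null fibre
  -- trivially, otherwise by the hypothesis on the conditional mean. Both tilts thus give the same
  -- mass to every point.
  have hF : Measurable F := .of_discrete
  have hset : ∀ b, ∫ a in {a | F a = b}, Real.exp (h a) ∂μ
      = ∫ a in {a | F a = b}, Real.exp (w (F a)) ∂μ := by
    intro b
    have h1 : ∫ a in {a | F a = b}, Real.exp (w (F a)) ∂μ
        = μ.real {a | F a = b} * Real.exp (w b) := by
      rw [setIntegral_congr_fun (g := fun _ => Real.exp (w b)) (.of_discrete)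
        (fun a ha => by rw [show F a = b from ha]), setIntegral_const, smul_eq_mul]
    rw [h1]
    by_cases hb : μ {a | F a = b} = 0
    · rw [Measure.restrict_eq_zero.2 hb, integral_zero_measure, measureReal_def, hb]
      simp
    · rw [← hw b hb, ProbabilityTheory.cond, integral_smul_measure, ENNReal.toReal_inv,
        smul_eq_mul, ← mul_assoc, measureReal_def,
        mul_inv_cancel₀ (ENNReal.toReal_ne_zero.2 ⟨hb, measure_ne_top _ _⟩), one_mul]
  have hint : ∀ f : α → ℝ, Integrable f μ := fun f => .of_finite
  have hfib : ∀ f : α → ℝ, ∫ a, f a ∂μ = ∑ b ∈ univ.image F, ∫ a in {a | F a = b}, f a ∂μ := by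
    intro f
    rw [← integral_biUnion_finset _ (fun _ _ => .of_discrete) _ fun _ _ => (hint f).integrableOn]
    · rw [← setIntegral_univ]
      congr 2
      ext a
      simp
    · intro b _ c _ hbc
      refine Set.disjoint_left.2 fun a ha hc => hbc ?_
      exact (show F a = b from ha).symm.trans hc
  have htot : ∫ a, Real.exp (h a) ∂μ = ∫ b, Real.exp (w b) ∂(μ.map F) := by
    rw [integral_map hF.aemeasurable (Measurable.of_discrete).aestronglyMeasurable, hfib, hfib]
    exact sum_congr rfl fun b _ => hset b
  have : IsProbabilityMeasure (μ.map F) := Measure.isProbabilityMeasure_map hF.aemeasurable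
  refine Measure.ext_of_singleton fun b => ?_
  rw [Measure.map_apply hF (.of_discrete), tilted_apply_eq_ofReal_integral,
    tilted_apply_eq_ofReal_integral, ← htot,
    setIntegral_map (.of_discrete) (Measurable.of_discrete).aestronglyMeasurable hF.aemeasurable]
  congr 1
  rw [integral_div, integral_div]
  congr 1
  exact hset b

/-- The relative entropy of a measure with respect to a tilted measure. -/
theorem klDiv_tilted_right {α : Type*} [MeasurableSpace α] (μ : Measure α) [IsProbabilityMeasure μ]
    {f : α → ℝ} (hf : Integrable f μ) (hef : Integrable (fun x => Real.exp (f x)) μ) :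
    InformationTheory.klDiv μ (μ.tilted f) ≠ ⊤ ∧
      (InformationTheory.klDiv μ (μ.tilted f)).toReal
        = Real.log (∫ x, Real.exp (f x) ∂μ) - ∫ x, f x ∂μ := by
  have hac := absolutelyContinuous_tilted hef
  have := isProbabilityMeasure_tilted hef
  have hz : Integrable (llr μ μ) μ := (integrable_zero _ _ _).congr (llr_self μ).symm
  refine ⟨InformationTheory.klDiv_ne_top hac
    (integrable_llr_tilted_right Measure.AbsolutelyContinuous.rfl hf hz hef), ?_⟩
  rw [InformationTheory.toReal_klDiv_of_measure_eq hac (by simp),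
    integral_llr_tilted_right Measure.AbsolutelyContinuous.rfl hf hef hz,
    integral_congr_ae (llr_self μ)]
  simp only [Pi.zero_apply, integral_zero]
  ring

theorem log_integral_exp_le {α : Type*} [MeasurableSpace α] (μ : Measure α) [IsProbabilityMeasure μ]
    {f g : α → ℝ} {ε : ℝ} (hf : Integrable (fun x => Real.exp (f x)) μ)
    (hg : Integrable (fun x => Real.exp (g x)) μ) (h : ∀ᵐ x ∂μ, f x ≤ g x + ε) :
    Real.log (∫ x, Real.exp (f x) ∂μ) ≤ Real.log (∫ x, Real.exp (g x) ∂μ) + ε := by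
  have h1 : ∫ x, Real.exp (f x) ∂μ ≤ ∫ x, Real.exp ε * Real.exp (g x) ∂μ := by
    refine integral_mono_ae hf (hg.const_mul _) (h.mono fun x hx => ?_)
    dsimp only
    rw [← Real.exp_add]
    exact Real.exp_le_exp.2 (by linarith)
  rw [integral_const_mul] at h1
  refine (Real.log_le_log (integral_exp_pos hf) h1).trans_eq ?_
  rw [Real.log_mul (Real.exp_pos _).ne' (integral_exp_pos hg).ne', Real.log_exp, add_comm]

namespace Model

variable {m q : ℕ} [NeZero m] [NeZero q] (A : Model m q)

instance : IsProbabilityMeasure A.coarsePrior :=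
  Measure.isProbabilityMeasure_map (Measurable.of_discrete).aemeasurable

theorem coarsePrior_singleton (η : Coarse m) :
    A.coarsePrior {η} = A.prior {σ | coarseMap σ = η} :=
  Measure.map_apply .of_discrete .of_discrete

/-- The coarse prior is carried by the finite range of `coarseMap`, so every function is almost
everywhere bounded. This also yields the finiteness of the relative entropy. -/
theorem integrable_of_ac {μ : Measure (Coarse m)} [IsFiniteMeasure μ] (h : μ ≪ A.coarsePrior)
    (f : Coarse m → ℝ) : Integrable f μ := by
  obtain ⟨C, hC⟩ := (Set.finite_range fun σ : Micro m q => ‖f (coarseMap σ)‖).bddAbove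
  have hae : ∀ᵐ η ∂A.coarsePrior, ‖f η‖ ≤ C := by
    rw [coarsePrior, ae_map_iff (Measurable.of_discrete).aemeasurable .of_discrete]
    exact Filter.Eventually.of_forall fun σ => hC ⟨σ, rfl⟩
  exact Integrable.of_bound (Measurable.of_discrete).aestronglyMeasurable C (h.ae_le hae)

instance : IsProbabilityMeasure A.coarseGibbs0 :=
  isProbabilityMeasure_tilted (A.integrable_of_ac Measure.AbsolutelyContinuous.rfl _)

theorem coarseGibbs0_ac : A.coarseGibbs0 ≪ A.coarsePrior :=
  tilted_absolutelyContinuous _ _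

theorem ae_prior_ne_zero : ∀ᵐ η ∂A.coarseGibbs0, A.prior {σ | coarseMap σ = η} ≠ 0 := by
  refine A.coarseGibbs0_ac.ae_le (ae_iff_of_countable.2 fun η hη => ?_)
  rwa [coarsePrior_singleton] at hη

/-- The exact coarse-grained Gibbs measure in terms of the first approximation. -/
theorem exactCoarseGibbs_eq (hm : Even m) :
    A.exactCoarseGibbs = A.coarseGibbs0.tilted fun η => Real.log (A.correction η) := by
  unfold exactCoarseGibbs gibbs coarseGibbs0
  rw [tilted_tilted (A.integrable_of_ac Measure.AbsolutelyContinuous.rfl _)]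
  refine map_tilted_eq A.prior coarseMap _ _ fun η hη => ?_
  refine (A.integral_exp_hamiltonian hm hη).trans ?_
  rw [Pi.add_apply, Real.exp_add, Real.exp_log (A.correction_pos hm hη)]

end Model

end Entropy

end CoarseGraining

end

/-! ### The relative entropy estimate. -/

theorem mainTheorem2 :
    ∃ δ₀ : ℝ, 0 < δ₀ ∧ ∃ δ₁ : ℝ, 0 < δ₁ ∧ ∃ C : ℝ, 0 < C ∧
      ∀ (m q : ℕ) [NeZero m] [NeZero q] (A : CoarseGraining.Model m q), Even m →
        (∀ k : ZMod m, Odd k.val → ∀ a : ℤ,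
          A.cellPrior k {τ | CoarseGraining.blockSpin τ = a} ≠ 0 →
          ∀ τ τ' : CoarseGraining.CellConf q, |A.fShort k a τ τ'| ≤ δ₀) →
        (∀ (k l : ZMod m) (σ : CoarseGraining.Micro m q), |A.fLong k l σ| ≤ δ₁) →
        InformationTheory.klDiv A.coarseGibbs0 A.exactCoarseGibbs ≠ ⊤ ∧
        |(InformationTheory.klDiv A.coarseGibbs0 A.exactCoarseGibbs).toReal -
            (A.β * ∫ η, A.coarse1 η ∂A.coarseGibbs0 +
              Real.log (∫ η, Real.exp (-A.β * A.coarse1 η) ∂A.coarseGibbs0))|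
          ≤ C * m * (q * A.delta) ^ 2 := by
  -- The threshold 1/2 is that of `abs_exp_sub_one_sub_le_sq`. The constant is 2 · 14500: the error
  -- of log G enters once through the log-moment and once through the mean.
  refine ⟨1 / 2, by norm_num, 1 / 2, by norm_num, 29000, by norm_num, ?_⟩
  intro m q _ _ A hm hs hl
  have hint := A.integrable_of_ac A.coarseGibbs0_ac
  obtain ⟨htop, hkl⟩ := CoarseGraining.klDiv_tilted_right A.coarseGibbs0
    (hint fun η => Real.log (A.correction η)) (hint _)
  rw [A.exactCoarseGibbs_eq hm]
  refine ⟨htop, ?_⟩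
  rw [hkl]
  set ε : ℝ := m * (14500 * (q * A.delta) ^ 2) with hε
  have hae : ∀ᵐ η ∂A.coarseGibbs0,
      |Real.log (A.correction η) - -A.β * A.coarse1 η| ≤ ε := by
    filter_upwards [A.ae_prior_ne_zero] with η hη
    exact A.abs_log_correction_sub_le hm hη
      (fun k hk => hs k hk _ (A.cellPrior_ne_zero hη k)) hl
  have h1 := CoarseGraining.log_integral_exp_le A.coarseGibbs0 (hint _) (hint _)
    (hae.mono fun η h => (sub_le_iff_le_add'.1 (abs_le.1 h).2))
  have h2 := CoarseGraining.log_integral_exp_le A.coarseGibbs0 (hint _) (hint _)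
    (hae.mono fun η h => show -A.β * A.coarse1 η ≤ Real.log (A.correction η) + ε by
      linarith [(abs_le.1 h).1])
  have h3 := norm_integral_le_of_norm_le_const (μ := A.coarseGibbs0)
    (f := fun η => Real.log (A.correction η) - -A.β * A.coarse1 η) hae
  rw [integral_sub (hint _) (hint _), integral_const_mul, probReal_univ, mul_one,
    Real.norm_eq_abs] at h3
  obtain ⟨h4, h5⟩ := abs_le.1 h3
  have h6 : 29000 * m * (q * A.delta) ^ 2 = 2 * ε := by rw [hε]; ring
  rw [h6, abs_le]
  constructor <;> linarith
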